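/- Let $d,k$ be integers with $1\le k\le d-1$ and let $\frac{d-k}{2}<\alpha<d-\frac{k}{2}$ (so that $0<\alpha<d$). Let $V\subset\mathbb{R}^d$ be any $(k+1)$-dimensional linear subspace, let $S^k=\{x\in V:|x|=1\}$, and let $\mu_k=\mathcal{H}^k\llcorner S^k$ be the restriction to $S^k$ of the $k$-dimensional Hausdorff measure. Then: (i) $\mu_k$ is a finite Radon measure on $\mathbb{R}^d$, and $\mu_k\in\dot B^{k-d}_{\infty,\infty}(\mathbb{R}^d)$, that is, $$\sup_{t>0}\,t^{\frac{d-k}{2}}\,\|p_t*\mu_k\|_{L^\infty(\mathbb{R}^d)}<\infty,\qquad p_t(x)=(4\pi t)^{-d/2}e^{-|x|^2/(4t)}.$$ (ii) The Riesz potential $$I_\alpha\mu_k(x)=\frac{1}{\gamma(\alpha)}\int_{\mathbb{R}^d}\frac{d\mu_k(y)}{|x-y|^{d-\alpha}},\qquad \gamma(\alpha)=\frac{\pi^{d/2}2^{\alpha}\,\Gamma(\alpha/2)}{\Gamma((d-\alpha)/2)},$$ is finite almost everywhere and defines a tempered distribution; its distributional Fourier transform (with the convention $\widehat{\varphi}(\xi)=\int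 e^{-2\pi i x\cdot\xi}\varphi(x)\,dx$) is given by a function $\widehat{I_\alpha\mu_k}$, and for every $0<q<\infty$, with $p=\frac{2d}{2\alpha+k}$, $$\|\widehat{I_\alpha\mu_k}\|_{L^{p,q}}:=\left(\int_0^\infty\Big(t\,\big|\{\xi\in\mathbb{R}^d:|\widehat{I_\alpha\mu_k}(\xi)|>t\}\big|^{1/p}\Big)^{q}\,\frac{dt}{t}\right)^{1/q}=+\infty .$$ -/

import Mathlib

open MeasureTheory
open scoped ENNReal FourierTransform SchwartzMap

/-- The Euclidean heat kernel `p_t(x) = (4πt)^{-d/2} exp(-|x|²/(4t))` on `ℝ^d`. -/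
noncomputable def heatKernel {d : ℕ} (t : ℝ) (x : EuclideanSpace ℝ (Fin d)) : ℝ :=
  (4 * Real.pi * t) ^ (-((d : ℝ) / 2)) * Real.exp (-‖x‖ ^ 2 / (4 * t))

/-- The convolution `(p_t ∗ μ)(x) = ∫ p_t(x - y) dμ(y)` of the heat kernel with a measure. -/
noncomputable def heatConv {d : ℕ} (μ : Measure (EuclideanSpace ℝ (Fin d))) (t : ℝ)
    (x : EuclideanSpace ℝ (Fin d)) : ℝ :=
  ∫ y, heatKernel t (x - y) ∂μ

/-- The norm of a finite measure `μ` in the homogeneous Besov space of order `β - d` with both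
indices infinite, `sup_{t > 0} t^{(d-β)/2} ‖p_t ∗ μ‖_{L^∞}`, as an extended real number;
`μ` lies in the space exactly when it is finite. -/
noncomputable def besovNorm {d : ℕ} (β : ℝ) (μ : Measure (EuclideanSpace ℝ (Fin d))) : ℝ≥0∞ :=
  ⨆ (t : ℝ) (_ : 0 < t), ENNReal.ofReal (t ^ (((d : ℝ) - β) / 2)) *
    eLpNorm (heatConv μ t) ⊤ volume

/-- The normalization constant `γ(α) = π^{d/2} 2^α Γ(α/2) / Γ((d-α)/2)` of the Riesz potential. -/
noncomputable def rieszConst (d : ℕ) (α : ℝ) : ℝ :=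
  Real.pi ^ ((d : ℝ) / 2) * 2 ^ α * Real.Gamma (α / 2) / Real.Gamma (((d : ℝ) - α) / 2)

/-- The Riesz potential `I_α μ (x) = γ(α)⁻¹ ∫ |x - y|^{α-d} dμ(y)` of a positive measure, with
values in `[0, ∞]` (for `α < d` the integrand is `∞` at `y = x`). -/
noncomputable def rieszPotential {d : ℕ} (α : ℝ) (μ : Measure (EuclideanSpace ℝ (Fin d)))
    (x : EuclideanSpace ℝ (Fin d)) : ℝ≥0∞ :=
  (ENNReal.ofReal (rieszConst d α))⁻¹ * ∫⁻ y, ‖x - y‖ₑ ^ (α - (d : ℝ)) ∂μ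

/-- `f` and `g` define tempered distributions by integration, and the Fourier transform of the
distribution `f` is the distribution `g`, i.e. `∫ f φ̂ = ∫ g φ` for every Schwartz function `φ`,
where `φ̂(ξ) = ∫ e^{-2πi x·ξ} φ(x) dx`. -/
structure HasDistribFourierTransform {d : ℕ} (f g : EuclideanSpace ℝ (Fin d) → ℂ) : Prop where
  integrable_left : ∀ φ : 𝓢(EuclideanSpace ℝ (Fin d), ℂ), Integrable (fun x => f x * φ x) volume
  integrable_right : ∀ φ : 𝓢(EuclideanSpace ℝ (Fin d), ℂ), Integrable (fun ξ => g ξ * φ ξ) volume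
  integral_eq : ∀ φ : 𝓢(EuclideanSpace ℝ (Fin d), ℂ), ∫ x, f x * 𝓕 φ x = ∫ ξ, g ξ * φ ξ

/-- The Lorentz quasi-norm
`‖g‖_{L^{p,q}} = (∫_0^∞ (t |{ξ : |g(ξ)| > t}|^{1/p})^q dt/t)^{1/q}` for `0 < p, q < ∞`. -/
noncomputable def lorentzNorm {d : ℕ} (p q : ℝ) (g : EuclideanSpace ℝ (Fin d) → ℂ) : ℝ≥0∞ :=
  (∫⁻ t in Set.Ioi (0 : ℝ),
    (ENNReal.ofReal t * volume {ξ | t < ‖g ξ‖} ^ (1 / p)) ^ q / ENNReal.ofReal t) ^ (1 / q)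

/-- The `k`-dimensional Hausdorff measure (normalized so that it is Lebesgue measure on
`k`-dimensional Euclidean space) restricted to the unit sphere of the subspace `V` of `ℝ^d`. -/
noncomputable def sphereMeasure {d : ℕ} (k : ℕ) (V : Submodule ℝ (EuclideanSpace ℝ (Fin d))) :
    Measure (EuclideanSpace ℝ (Fin d)) :=
  (μHE[k]).restrict {x | x ∈ V ∧ ‖x‖ = 1}

/-! ### Geometry of the sphere measure: `k`-dimensional growth and nontriviality. -/

section SphereGeometry

/-! Write μ for the sphere measure. Covering the sphere by finitely many caps that are bi-Lipschitz
to pieces of `ℝ^k` gives μ(B(x,r)) ≤ C r^k. Slicing the Gaussian into balls of radius (n+1)√t turns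
this growth into the Besov bound.

The Riesz kernel is a superposition of Gaussians, so the Fourier transform of I_α μ is (2π|ξ|)^{-α}
μ̂(ξ) (`integral_rieszKernel_mul_fourier`, `hasDistribFourierTransform_rieszPotential`), and any
other representative agrees with it almost everywhere.

The failure of the Lorentz bound comes from the exact decay rate of μ̂. By rotation invariance μ̂(ξ)
= F(2π|Pξ|), with P the orthogonal projection onto `V` and F(r) = ∫ cos(r⟨x,e⟩) dμ for any unit `e`
in `V`. Instead of Bessel asymptotics, an ODE is used: invariance gives F'' + (k/r)F' + F = 0
(`radial_helmholtz`), so u = r^{k/2}F solves u'' = (m/r² - 1)u. Its energy u'² + u² stays between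
positive constants, and since u oscillates, |u| ≥ η on a fixed proportion of every [R, 2R] with R
large (`exists_volume_lower_bound`).

Passing from radii to ξ (`exists_volume_ball_lower_bound`), the transform of I_α μ is at least a
multiple of R^{-(α+k/2)} on a set of measure at least a multiple of R^d. Choosing R in terms of t,
the distribution function is at least c t^{-p} for small t, where p = d/(α+k/2). The Lorentz
integrand is then at least a constant times 1/t near 0, and its integral diverges for every finite
q. -/

theorem LipschitzOnWith.euclideanHausdorffMeasure_image_le {X Y : Type*} [EMetricSpace X]
    [EMetricSpace Y] [MeasurableSpace X] [BorelSpace X] [MeasurableSpace Y] [BorelSpace Y]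
    {K : NNReal} {f : X → Y} {s : Set X} (h : LipschitzOnWith K f s) (n : ℕ) :
    (μHE[n] : Measure Y) (f '' s) ≤ (K : ℝ≥0∞) ^ n * (μHE[n] : Measure X) s := by
  have h1 := h.hausdorffMeasure_image_le (d := (n : ℝ)) (Nat.cast_nonneg n)
  rw [ENNReal.rpow_natCast] at h1
  simp only [Measure.euclideanHausdorffMeasure_def, Measure.smul_apply, ENNReal.smul_def,
    smul_eq_mul]
  calc _ ≤ _ := mul_le_mul_right h1 _
    _ = _ := by ring

variable {d k : ℕ} {V : Submodule ℝ (EuclideanSpace ℝ (Fin d))}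

theorem measurableSet_subspace_sphere (V : Submodule ℝ (EuclideanSpace ℝ (Fin d))) :
    MeasurableSet {x | x ∈ V ∧ ‖x‖ = 1} :=
  (V.closed_of_finiteDimensional.inter (isClosed_eq continuous_norm continuous_const)).measurableSet

theorem sphereMeasure_ae_mem (k : ℕ) (V : Submodule ℝ (EuclideanSpace ℝ (Fin d))) :
    ∀ᵐ x ∂(sphereMeasure k V), x ∈ V ∧ ‖x‖ = 1 :=
  ae_restrict_mem (measurableSet_subspace_sphere V)

/-- The sphere measure is invariant under linear isometries which preserve the subspace. -/
theorem measurePreserving_sphereMeasure (k : ℕ)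
    (L : EuclideanSpace ℝ (Fin d) ≃ₗᵢ[ℝ] EuclideanSpace ℝ (Fin d)) (hL : ∀ x, L x ∈ V ↔ x ∈ V) :
    MeasurePreserving L (sphereMeasure k V) (sphereMeasure k V) := by
  have h := (L.toIsometryEquiv.measurePreserving_euclideanHausdorffMeasure k).restrict_preimage
    (measurableSet_subspace_sphere V)
  have e : L.toIsometryEquiv ⁻¹' {x | x ∈ V ∧ ‖x‖ = 1} = {x | x ∈ V ∧ ‖x‖ = 1} := by
    ext x; simp [hL]
  rw [e] at h
  exact h

/-- The coordinates of a vector in an orthonormal basis of a subspace, omitting one of them. -/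
noncomputable def coordsExcept (b : OrthonormalBasis (Fin (k + 1)) ℝ V) (j : Fin (k + 1))
    (x : EuclideanSpace ℝ (Fin d)) : EuclideanSpace ℝ (Fin k) :=
  WithLp.toLp 2 fun i => inner ℝ (b (j.succAbove i) : EuclideanSpace ℝ (Fin d)) x

theorem coordsExcept_sub (b : OrthonormalBasis (Fin (k + 1)) ℝ V) (j : Fin (k + 1))
    (x y : EuclideanSpace ℝ (Fin d)) :
    coordsExcept b j (x - y) = coordsExcept b j x - coordsExcept b j y := by
  ext i; simp [coordsExcept, inner_sub_right]

theorem sum_sq_inner_of_mem (b : OrthonormalBasis (Fin (k + 1)) ℝ V)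
    {x : EuclideanSpace ℝ (Fin d)} (hx : x ∈ V) :
    ∑ i, (inner ℝ (b i : EuclideanSpace ℝ (Fin d)) x) ^ 2 = ‖x‖ ^ 2 := by
  have := b.sum_sq_norm_inner_right ⟨x, hx⟩
  simpa [Submodule.coe_inner, sq_abs] using this

theorem sq_inner_add_sq_norm_coordsExcept (b : OrthonormalBasis (Fin (k + 1)) ℝ V)
    (j : Fin (k + 1)) {x : EuclideanSpace ℝ (Fin d)} (hx : x ∈ V) :
    (inner ℝ (b j : EuclideanSpace ℝ (Fin d)) x) ^ 2 + ‖coordsExcept b j x‖ ^ 2 = ‖x‖ ^ 2 := by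
  rw [← sum_sq_inner_of_mem b hx, Fin.sum_univ_succAbove _ j, EuclideanSpace.norm_sq_eq]
  simp [coordsExcept, sq_abs]

theorem norm_coordsExcept_le (b : OrthonormalBasis (Fin (k + 1)) ℝ V)
    (j : Fin (k + 1)) {x : EuclideanSpace ℝ (Fin d)} (hx : x ∈ V) :
    ‖coordsExcept b j x‖ ≤ ‖x‖ := by
  have := sq_inner_add_sq_norm_coordsExcept b j hx
  nlinarith [norm_nonneg x, norm_nonneg (coordsExcept b j x),
    sq_nonneg (inner ℝ (b j : EuclideanSpace ℝ (Fin d)) x)]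

/-- Two points of the unit sphere on the same side of, and at distance at least `c` from, the
hyperplane orthogonal to `b j` are controlled by their other coordinates. -/
theorem norm_sub_le_of_cap (b : OrthonormalBasis (Fin (k + 1)) ℝ V) (j : Fin (k + 1))
    {x y : EuclideanSpace ℝ (Fin d)} (hx : x ∈ V) (hy : y ∈ V) (hx1 : ‖x‖ = 1) (hy1 : ‖y‖ = 1)
    {c σ : ℝ} (hc : 0 < c) (hσ : σ ^ 2 = 1)
    (hcx : c ≤ σ * inner ℝ (b j : EuclideanSpace ℝ (Fin d)) x)
    (hcy : c ≤ σ * inner ℝ (b j : EuclideanSpace ℝ (Fin d)) y) :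
    ‖x - y‖ ≤ (1 + c⁻¹) * ‖coordsExcept b j x - coordsExcept b j y‖ := by
  have h1 := sq_inner_add_sq_norm_coordsExcept b j hx
  have h2 := sq_inner_add_sq_norm_coordsExcept b j hy
  have h3 := sq_inner_add_sq_norm_coordsExcept b j (V.sub_mem hx hy)
  rw [inner_sub_right, coordsExcept_sub] at h3
  have h4 : ‖coordsExcept b j x‖ ≤ 1 := hx1 ▸ norm_coordsExcept_le b j hx
  have h5 : ‖coordsExcept b j y‖ ≤ 1 := hy1 ▸ norm_coordsExcept_le b j hy
  have h6 := abs_norm_sub_norm_le (coordsExcept b j x) (coordsExcept b j y)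
  set p := coordsExcept b j x
  set q := coordsExcept b j y
  set s := inner ℝ (b j : EuclideanSpace ℝ (Fin d)) x
  set t := inner ℝ (b j : EuclideanSpace ℝ (Fin d)) y
  rw [hx1] at h1
  rw [hy1] at h2
  -- Subtracting s² + |p|² = 1 and t² + |q|² = 1 and factoring both differences of squares; being on
  -- the same side gives |s + t| ≥ 2c.
  have h7 : |s - t| * (2 * c) ≤ 2 * ‖p - q‖ := by
    have e : |s - t| * |s + t| = |‖p‖ - ‖q‖| * (‖p‖ + ‖q‖) := by
      nth_rewrite 1 [← abs_of_nonneg (add_nonneg (norm_nonneg p) (norm_nonneg q))]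
      rw [← abs_mul, ← abs_mul, ← abs_neg]
      congr 1; linarith
    have f : 2 * c ≤ |s + t| := by
      have hs1 : |σ| = 1 := by
        rwa [← pow_eq_one_iff_of_nonneg (abs_nonneg _) two_ne_zero, sq_abs]
      calc 2 * c ≤ σ * (s + t) := by linarith
        _ ≤ |σ * (s + t)| := le_abs_self _
        _ = |s + t| := by rw [abs_mul, hs1, one_mul]
    calc |s - t| * (2 * c) ≤ |s - t| * |s + t| := by gcongr
      _ = _ := e
      _ ≤ ‖p - q‖ * 2 := by gcongr; linarith
      _ = _ := by ring
  have h8 : |s - t| ≤ c⁻¹ * ‖p - q‖ := by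
    rw [inv_mul_eq_div, le_div_iff₀ hc]; linarith
  refine abs_le_of_sq_le_sq' ?_ (by positivity) |>.2
  rw [← h3, ← sq_abs (s - t)]
  have : 0 ≤ c⁻¹ * ‖p - q‖ := by positivity
  nlinarith [norm_nonneg (p - q), abs_nonneg (s - t)]

/-- The k+1 squared coordinates sum to 1, so one of them is at least 1/(k+1); a coordinate of
modulus at most 1 dominates its own square. -/
theorem exists_cap (b : OrthonormalBasis (Fin (k + 1)) ℝ V) {x : EuclideanSpace ℝ (Fin d)}
    (hx : x ∈ V) (hx1 : ‖x‖ = 1) :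
    ∃ (j : Fin (k + 1)) (σ : Bool),
      ((k : ℝ) + 1)⁻¹ ≤ (if σ then 1 else -1) * inner ℝ (b j : EuclideanSpace ℝ (Fin d)) x := by
  have h := sum_sq_inner_of_mem b hx
  rw [hx1] at h
  obtain ⟨j, -, hj⟩ : ∃ j ∈ Finset.univ, ((k : ℝ) + 1)⁻¹ ≤
      (inner ℝ (b j : EuclideanSpace ℝ (Fin d)) x) ^ 2 := by
    apply Finset.exists_le_of_sum_le Finset.univ_nonempty
    rw [h]
    simp
    field_simp
    rfl
  have h1 : |inner ℝ (b j : EuclideanSpace ℝ (Fin d)) x| ≤ 1 := by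
    refine (abs_real_inner_le_norm _ _).trans ?_
    have : ‖(b j : EuclideanSpace ℝ (Fin d))‖ = 1 := b.norm_eq_one j
    rw [hx1, this]; norm_num
  have h2 : ((k : ℝ) + 1)⁻¹ ≤ |inner ℝ (b j : EuclideanSpace ℝ (Fin d)) x| := by
    rw [← sq_abs] at hj
    nlinarith [abs_nonneg (inner ℝ (b j : EuclideanSpace ℝ (Fin d)) x)]
  rcases le_abs.1 h2 with h | h
  · exact ⟨j, true, by simpa using h⟩
  · exact ⟨j, false, by simpa using h⟩

theorem exists_orthonormalBasis_subspace (hV : Module.finrank ℝ V = k + 1) :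
    Nonempty (OrthonormalBasis (Fin (k + 1)) ℝ V) :=
  ⟨(stdOrthonormalBasis ℝ V).reindex (finCongr hV)⟩

/-- The sphere measure is `k`-dimensional: balls of radius `r` have measure at most `C r ^ k`. -/
theorem exists_sphereMeasure_closedBall_le (hV : Module.finrank ℝ V = k + 1) :
    ∃ C : ℝ, 0 < C ∧ ∀ (x : EuclideanSpace ℝ (Fin d)) (r : ℝ), 0 < r →
      sphereMeasure k V (Metric.closedBall x r) ≤ ENNReal.ofReal (C * r ^ k) := by
  obtain ⟨b⟩ := exists_orthonormalBasis_subspace hV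
  set c : ℝ := ((k : ℝ) + 1)⁻¹ with hc
  have hc0 : 0 < c := by positivity
  set K : ℝ := 1 + c⁻¹ with hK
  have hK0 : 0 < K := by positivity
  set M : ℝ := (volume (Metric.ball (0 : EuclideanSpace ℝ (Fin k)) 1)).toReal with hM
  have hMf : volume (Metric.ball (0 : EuclideanSpace ℝ (Fin k)) 1) = ENNReal.ofReal M :=
    (ENNReal.ofReal_toReal measure_ball_lt_top.ne).symm
  have hM0 : 0 < M := ENNReal.toReal_pos (Metric.measure_ball_pos _ _ one_pos).ne'
    measure_ball_lt_top.ne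
  -- There are 2(k+1) caps. Each cap piece in the ball is the image, under a K-Lipschitz inverse of
  -- the coordinate map, of a subset of a k-dimensional ball of radius 2r.
  refine ⟨(k + 1) * 2 * (K ^ k * (2 ^ k * M)), by positivity, fun x r hr => ?_⟩
  let T : Fin (k + 1) × Bool → Set (EuclideanSpace ℝ (Fin d)) := fun p =>
    {y | (y ∈ V ∧ ‖y‖ = 1) ∧ y ∈ Metric.closedBall x r ∧
      c ≤ (if p.2 then 1 else -1) * inner ℝ (b p.1 : EuclideanSpace ℝ (Fin d)) y}
  have hT : ∀ p, (μHE[k] : Measure (EuclideanSpace ℝ (Fin d))) (T p) ≤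
      ENNReal.ofReal (K ^ k * (2 ^ k * M) * r ^ k) := by
    intro p
    have hdist : ∀ y ∈ T p, ∀ z ∈ T p,
        dist y z ≤ K * dist (coordsExcept b p.1 y) (coordsExcept b p.1 z) := by
      intro y hy z hz
      rw [dist_eq_norm, dist_eq_norm]
      refine norm_sub_le_of_cap b p.1 hy.1.1 hz.1.1 hy.1.2 hz.1.2 hc0 ?_ hy.2.2 hz.2.2
      split_ifs <;> norm_num
    have hinj : Set.InjOn (coordsExcept b p.1) (T p) := by
      intro y hy z hz h
      have := hdist y hy z hz
      rw [h, dist_self, mul_zero] at this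
      exact dist_le_zero.1 this
    have hlip : LipschitzOnWith K.toNNReal (Function.invFunOn (coordsExcept b p.1) (T p))
        (coordsExcept b p.1 '' T p) := by
      refine LipschitzOnWith.of_dist_le_mul ?_
      rintro _ ⟨y, hy, rfl⟩ _ ⟨z, hz, rfl⟩
      rw [hinj.leftInvOn_invFunOn hy, hinj.leftInvOn_invFunOn hz, Real.coe_toNNReal _ hK0.le]
      exact hdist y hy z hz
    have h1 := hlip.euclideanHausdorffMeasure_image_le k
    rw [hinj.leftInvOn_invFunOn.image_image,
      EuclideanSpace.euclideanHausdorffMeasure_eq_volume] at h1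
    have h2 : volume (coordsExcept b p.1 '' T p) ≤ ENNReal.ofReal ((2 * r) ^ k * M) := by
      rcases (T p).eq_empty_or_nonempty with h | ⟨z, hz⟩
      · simp [h]
      · refine (measure_mono (t := Metric.closedBall (coordsExcept b p.1 z) (2 * r)) ?_).trans ?_
        · rintro _ ⟨y, hy, rfl⟩
          rw [Metric.mem_closedBall, dist_eq_norm, ← coordsExcept_sub]
          refine (norm_coordsExcept_le b p.1 (V.sub_mem hy.1.1 hz.1.1)).trans ?_
          rw [← dist_eq_norm]
          have := dist_triangle_right y z x
          have h3 := Metric.mem_closedBall.1 hy.2.1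
          have h4 := Metric.mem_closedBall.1 hz.2.1
          linarith
        · rw [Measure.addHaar_closedBall _ _ (by positivity), finrank_euclideanSpace_fin, hMf,
            ← ENNReal.ofReal_mul (by positivity)]
    refine (h1.trans (mul_le_mul_right h2 _)).trans ?_
    change ENNReal.ofReal K ^ k * _ ≤ _
    rw [← ENNReal.ofReal_pow (by positivity), ← ENNReal.ofReal_mul (by positivity)]
    refine ENNReal.ofReal_le_ofReal (le_of_eq ?_)
    rw [mul_pow]; ring
  have hcover : Metric.closedBall x r ∩ {y | y ∈ V ∧ ‖y‖ = 1} ⊆ ⋃ p, T p := by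
    rintro y ⟨hy, hyV⟩
    obtain ⟨j, σ, h⟩ := exists_cap b hyV.1 hyV.2
    exact Set.mem_iUnion.2 ⟨(j, σ), hyV, hy, h⟩
  rw [sphereMeasure, Measure.restrict_apply' (measurableSet_subspace_sphere V)]
  refine (measure_mono hcover).trans ((measure_iUnion_fintype_le _ _).trans ?_)
  refine (Finset.sum_le_sum fun p _ => hT p).trans ?_
  rw [Finset.sum_const, nsmul_eq_mul, ← ENNReal.ofReal_natCast,
    ← ENNReal.ofReal_mul (Nat.cast_nonneg _), Finset.card_univ, Fintype.card_prod,
    Fintype.card_fin, Fintype.card_bool]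
  refine ENNReal.ofReal_le_ofReal (le_of_eq ?_)
  push_cast
  ring

theorem isFiniteMeasure_sphereMeasure (hV : Module.finrank ℝ V = k + 1) :
    IsFiniteMeasure (sphereMeasure k V) := by
  obtain ⟨C, -, hC⟩ := exists_sphereMeasure_closedBall_le hV
  refine ⟨?_⟩
  have h : sphereMeasure k V Set.univ = sphereMeasure k V (Metric.closedBall 0 1) := by
    refine measure_congr ?_
    filter_upwards [sphereMeasure_ae_mem k V] with x hx
    apply propext
    change True ↔ x ∈ Metric.closedBall 0 1
    simp [hx.2]
  rw [h]
  exact (hC 0 1 one_pos).trans_lt ENNReal.ofReal_lt_top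

/-- Dropping one coordinate is 1-Lipschitz, and the image of the sphere contains the open unit ball
of `ℝ^k`: lift `w` by the missing coordinate √(1 - |w|²). -/
theorem sphereMeasure_ne_zero (hV : Module.finrank ℝ V = k + 1) : sphereMeasure k V ≠ 0 := by
  obtain ⟨b⟩ := exists_orthonormalBasis_subspace hV
  intro h0
  have h1 : (μHE[k] : Measure (EuclideanSpace ℝ (Fin d))) {x | x ∈ V ∧ ‖x‖ = 1} = 0 := by
    have : sphereMeasure k V Set.univ = 0 := by simp [h0]
    simpa [sphereMeasure] using this
  have hlip : LipschitzOnWith 1 (coordsExcept b 0) {x | x ∈ V ∧ ‖x‖ = 1} := by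
    refine LipschitzOnWith.of_dist_le_mul fun x hx y hy => ?_
    rw [dist_eq_norm, dist_eq_norm, ← coordsExcept_sub, NNReal.coe_one, one_mul]
    exact norm_coordsExcept_le b 0 (V.sub_mem hx.1 hy.1)
  have h2 := hlip.euclideanHausdorffMeasure_image_le k
  rw [h1, mul_zero, EuclideanSpace.euclideanHausdorffMeasure_eq_volume] at h2
  have h3 : Metric.ball (0 : EuclideanSpace ℝ (Fin k)) 1 ⊆
      coordsExcept b 0 '' {x | x ∈ V ∧ ‖x‖ = 1} := by
    intro w hw
    have hw1 : ‖w‖ < 1 := by simpa using hw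
    let z : EuclideanSpace ℝ (Fin (k + 1)) :=
      WithLp.toLp 2 (Fin.cons (√(1 - ‖w‖ ^ 2)) w)
    have hz : ∀ i, inner ℝ (b i : EuclideanSpace ℝ (Fin d)) (b.repr.symm z : V) = z i := by
      intro i
      rw [← Submodule.coe_inner, ← b.repr_apply_apply, LinearIsometryEquiv.apply_symm_apply]
    refine ⟨(b.repr.symm z : V), ⟨(b.repr.symm z).2, ?_⟩, ?_⟩
    · have : ‖(b.repr.symm z : V)‖ = ‖z‖ := b.repr.symm.norm_map z
      rw [← Submodule.coe_norm, this, ← pow_eq_one_iff_of_nonneg (norm_nonneg _) two_ne_zero,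
        EuclideanSpace.norm_sq_eq, Fin.sum_univ_succ]
      have hw2 : ‖w‖ ^ 2 = ∑ i, (w i) ^ 2 := by simp [EuclideanSpace.norm_sq_eq]
      have h4 : 0 ≤ 1 - ‖w‖ ^ 2 := by nlinarith [norm_nonneg w]
      simp [z, Real.sq_sqrt h4, ← hw2]
    · ext i
      simp [coordsExcept, hz, z]
  exact (Metric.measure_ball_pos volume (0 : EuclideanSpace ℝ (Fin k)) one_pos).ne'
    (measure_mono_null h3 (le_antisymm h2 bot_le))

end SphereGeometry

/-! ### From ball growth to the Besov bound. -/

section BesovBound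

variable {d k : ℕ} {μ : Measure (EuclideanSpace ℝ (Fin d))}

/-- With b = a/√t, (b - 1)² ≥ 0 makes b²/4 dominate a linear function of b. The resulting weight is
constant on each shell n ≤ b < n+1 and summable against (n+1)^k. -/
theorem exp_neg_sq_div_le_of_floor {a t : ℝ} (ha : 0 ≤ a) (ht : 0 < t) :
    Real.exp (-a ^ 2 / (4 * t)) ≤
      Real.exp 1 * Real.exp (-(1 / 2) * ((⌊a / √t⌋₊ + 1 : ℕ) : ℝ)) := by
  rw [← Real.exp_add]
  apply Real.exp_le_exp.2
  have h1 : (⌊a / √t⌋₊ : ℝ) ≤ a / √t := Nat.floor_le (by positivity)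
  have h2 : a ^ 2 / (4 * t) = (a / √t) ^ 2 / 4 := by
    rw [div_pow, Real.sq_sqrt ht.le]; field_simp
  rw [neg_div, h2]
  push_cast
  nlinarith [sq_nonneg (a / √t - 1)]

/-- Gaussian integrals against a measure satisfying a ball growth condition. -/
theorem exists_lintegral_gaussian_le {C : ℝ} (hC : 0 < C)
    (hμ : ∀ (x : EuclideanSpace ℝ (Fin d)) (r : ℝ), 0 < r →
      μ (Metric.closedBall x r) ≤ ENNReal.ofReal (C * r ^ k)) :
    ∃ A : ℝ, 0 ≤ A ∧ ∀ (t : ℝ) (x : EuclideanSpace ℝ (Fin d)), 0 < t →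
      ∫⁻ y, ENNReal.ofReal (Real.exp (-‖x - y‖ ^ 2 / (4 * t))) ∂μ ≤
        ENNReal.ofReal (A * √t ^ k) := by
  let w : ℕ → ℝ := fun n => Real.exp 1 * Real.exp (-(1 / 2) * ((n + 1 : ℕ) : ℝ))
  let c : ℕ → ℝ := fun n => ((n + 1 : ℕ) : ℝ) ^ k * Real.exp (-(1 / 2) * ((n + 1 : ℕ) : ℝ))
  have hc : Summable c := (summable_nat_add_iff 1).2
    (Real.summable_pow_mul_exp_neg_nat_mul k (r := 1 / 2) (by norm_num))
  have hc0 : ∀ n, 0 ≤ c n := fun n => by positivity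
  refine ⟨Real.exp 1 * C * ∑' n, c n, mul_nonneg (by positivity) (tsum_nonneg hc0),
    fun t x ht => ?_⟩
  have hs : 0 < √t := Real.sqrt_pos.2 ht
  -- The single term of index n = ⌊|x-y|/√t⌋ already dominates; full balls replace shells because
  -- growth is known for balls.
  have hpt : ∀ y, ENNReal.ofReal (Real.exp (-‖x - y‖ ^ 2 / (4 * t))) ≤
      ∑' n : ℕ, (Metric.closedBall x (((n + 1 : ℕ) : ℝ) * √t)).indicator
        (fun _ => ENNReal.ofReal (w n)) y := by
    intro y
    refine le_trans ?_ (ENNReal.le_tsum ⌊‖x - y‖ / √t⌋₊)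
    rw [Set.indicator_of_mem]
    · exact ENNReal.ofReal_le_ofReal (exp_neg_sq_div_le_of_floor (norm_nonneg _) ht)
    · rw [Metric.mem_closedBall, dist_comm, dist_eq_norm]
      have := Nat.lt_floor_add_one (‖x - y‖ / √t)
      rw [div_lt_iff₀ hs] at this
      push_cast
      exact this.le
  calc ∫⁻ y, ENNReal.ofReal (Real.exp (-‖x - y‖ ^ 2 / (4 * t))) ∂μ
      ≤ ∫⁻ y, ∑' n : ℕ, (Metric.closedBall x (((n + 1 : ℕ) : ℝ) * √t)).indicator
        (fun _ => ENNReal.ofReal (w n)) y ∂μ := lintegral_mono hpt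
    _ = ∑' n : ℕ, ENNReal.ofReal (w n) * μ (Metric.closedBall x (((n + 1 : ℕ) : ℝ) * √t)) := by
      rw [lintegral_tsum fun n =>
        (measurable_const.indicator measurableSet_closedBall).aemeasurable]
      exact tsum_congr fun n => lintegral_indicator_const measurableSet_closedBall _
    _ ≤ ∑' n : ℕ, ENNReal.ofReal (Real.exp 1 * C * √t ^ k * c n) := by
      refine ENNReal.tsum_le_tsum fun n => ?_
      refine (mul_le_mul_right (hμ x _ (by positivity)) _).trans ?_
      rw [← ENNReal.ofReal_mul (by positivity)]
      refine ENNReal.ofReal_le_ofReal (le_of_eq ?_)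
      simp only [w, c, mul_pow]
      ring
    _ = ENNReal.ofReal ((Real.exp 1 * C * ∑' n, c n) * √t ^ k) := by
      rw [← ENNReal.ofReal_tsum_of_nonneg (fun n => mul_nonneg (by positivity) (hc0 n))
        (hc.mul_left _), tsum_mul_left]
      congr 1
      ring

/-- The powers of t cancel: (d-k)/2 from the norm, -d/2 from the heat kernel, k/2 from the growth.
-/
theorem besovNorm_lt_top {C : ℝ} (hC : 0 < C)
    (hμ : ∀ (x : EuclideanSpace ℝ (Fin d)) (r : ℝ), 0 < r →
      μ (Metric.closedBall x r) ≤ ENNReal.ofReal (C * r ^ k)) :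
    besovNorm (k : ℝ) μ < ⊤ := by
  obtain ⟨A, hA, h⟩ := exists_lintegral_gaussian_le hC hμ
  refine lt_of_le_of_lt (b := ENNReal.ofReal ((4 * Real.pi) ^ (-((d : ℝ) / 2)) * A)) ?_
    ENNReal.ofReal_lt_top
  refine iSup₂_le fun t ht => ?_
  have hb : eLpNorm (heatConv μ t) ⊤ volume ≤
      ENNReal.ofReal ((4 * Real.pi * t) ^ (-((d : ℝ) / 2)) * (A * √t ^ k)) := by
    rw [eLpNorm_exponent_top]
    refine essSup_le_of_ae_le _ (Filter.Eventually.of_forall fun x => ?_)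
    refine (enorm_integral_le_lintegral_enorm _).trans ?_
    have : ∀ y, ‖heatKernel t (x - y)‖ₑ = ENNReal.ofReal ((4 * Real.pi * t) ^ (-((d : ℝ) / 2))) *
        ENNReal.ofReal (Real.exp (-‖x - y‖ ^ 2 / (4 * t))) := by
      intro y
      rw [heatKernel, Real.enorm_of_nonneg (by positivity), ENNReal.ofReal_mul (by positivity)]
    simp_rw [this]
    rw [lintegral_const_mul' _ _ ENNReal.ofReal_ne_top, ENNReal.ofReal_mul (by positivity)]
    exact mul_le_mul_right (h t x ht) _
  refine (mul_le_mul_right hb _).trans ?_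
  rw [← ENNReal.ofReal_mul (by positivity)]
  refine ENNReal.ofReal_le_ofReal (le_of_eq ?_)
  have h1 : √t ^ k = t ^ ((k : ℝ) / 2) := by
    rw [Real.sqrt_eq_rpow, ← Real.rpow_natCast, ← Real.rpow_mul ht.le]
    congr 1; ring
  have h2 : t ^ (((d : ℝ) - k) / 2) * t ^ (-((d : ℝ) / 2)) * t ^ ((k : ℝ) / 2) = 1 := by
    rw [← Real.rpow_add ht, ← Real.rpow_add ht]
    convert Real.rpow_zero t using 2
    ring
  rw [h1, Real.mul_rpow (by positivity) ht.le]
  linear_combination ((4 * Real.pi) ^ (-((d : ℝ) / 2)) * A) * h2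

end BesovBound

/-! ### Local integrability of the Riesz kernel. -/

section RieszKernel

variable {d : ℕ}

/-- The point 0 is excluded because for `s < 0` the extended power there is `⊤` while the real power
is 0. -/
theorem enorm_rpow_neg_eq_ofReal {E : Type*} [NormedAddCommGroup E] {x : E} (hx : x ≠ 0) (s : ℝ) :
    ‖x‖ₑ ^ s = ENNReal.ofReal (‖x‖ ^ s) := by
  rw [← ofReal_norm, ENNReal.ofReal_rpow_of_pos (norm_pos_iff.2 hx)]

/-- In polar coordinates the integrand is r^{d-1-s}, whose exponent exceeds -1. -/
theorem lintegral_ball_enorm_rpow_lt_top (hd : 0 < d) {s : ℝ} (hs : s < d) :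
    ∫⁻ x in Metric.ball (0 : EuclideanSpace ℝ (Fin d)) 1, ‖x‖ₑ ^ (-s) < ⊤ := by
  have : NeZero d := ⟨hd.ne'⟩
  have : Nontrivial (EuclideanSpace ℝ (Fin d)) := by
    apply Module.nontrivial_of_finrank_pos (R := ℝ); simpa using hd
  have h : IntegrableOn (fun x : EuclideanSpace ℝ (Fin d) => ‖x‖ ^ (-s)) (Metric.ball 0 1)
      volume := by
    rw [integrableOn_fun_norm_addHaar volume (f := fun r => r ^ (-s)), finrank_euclideanSpace_fin]
    have h1 : IntegrableOn (fun y : ℝ => y ^ ((d : ℝ) - 1 - s)) (Set.Ioo 0 1) volume :=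
      (intervalIntegral.integrableOn_Ioo_rpow_iff one_pos).2 (by linarith)
    refine h1.congr_fun (fun y hy => ?_) measurableSet_Ioo
    have : (y : ℝ) ^ (d - 1) = y ^ ((d : ℝ) - 1) := by
      rw [← Real.rpow_natCast, Nat.cast_sub hd, Nat.cast_one]
    simp only [smul_eq_mul]
    rw [this, ← Real.rpow_add hy.1]
    congr 1
  refine lt_of_eq_of_lt (lintegral_congr_ae (ae_restrict_of_ae ?_)) h.hasFiniteIntegral
  filter_upwards [compl_mem_ae_iff.2 (measure_singleton (0 : EuclideanSpace ℝ (Fin d)))] with x hx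
  have hx : x ≠ 0 := hx
  rw [enorm_rpow_neg_eq_ofReal hx, Real.enorm_of_nonneg (by positivity)]

theorem enorm_rpow_neg_le_one_add {s : ℝ} (hs : 0 ≤ s) (z : EuclideanSpace ℝ (Fin d)) :
    ‖z‖ₑ ^ (-s) ≤ 1 + (Metric.ball 0 1).indicator (fun z => ‖z‖ₑ ^ (-s)) z := by
  by_cases hz : z ∈ Metric.ball (0 : EuclideanSpace ℝ (Fin d)) 1
  · rw [Set.indicator_of_mem hz]; exact le_add_self
  · rw [Set.indicator_of_notMem hz, add_zero, ENNReal.rpow_neg, ENNReal.inv_le_one]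
    rcases hs.eq_or_lt with rfl | hs
    · simp
    apply ENNReal.one_le_rpow _ hs
    have : 1 ≤ ‖z‖ := by simpa using hz
    rwa [← ofReal_norm, ENNReal.one_le_ofReal]

/-- Convolving `|x| ^ (-s)`, `0 ≤ s < d`, with a bounded integrable function gives a bounded
function. -/
theorem exists_lintegral_rieszKernel_le (hd : 0 < d) {s : ℝ} (hs0 : 0 ≤ s) (hs : s < d)
    {F : EuclideanSpace ℝ (Fin d) → ℝ≥0∞} (hF : Measurable F) {M : ℝ≥0∞} (hM : M ≠ ⊤)
    (hFM : ∀ x, F x ≤ M) (hFi : ∫⁻ x, F x ≠ ⊤) :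
    ∃ B : ℝ≥0∞, B ≠ ⊤ ∧ ∀ y, ∫⁻ x, ‖x - y‖ₑ ^ (-s) * F x ≤ B := by
  refine ⟨(∫⁻ x, F x) + M * ∫⁻ x in Metric.ball (0 : EuclideanSpace ℝ (Fin d)) 1, ‖x‖ₑ ^ (-s),
    ENNReal.add_ne_top.2 ⟨hFi, ENNReal.mul_ne_top hM (lintegral_ball_enorm_rpow_lt_top hd hs).ne⟩,
    fun y => ?_⟩
  have hm : Measurable fun z : EuclideanSpace ℝ (Fin d) =>
      (Metric.ball 0 1).indicator (fun z => ‖z‖ₑ ^ (-s)) z :=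
    Measurable.indicator (by fun_prop) measurableSet_ball
  calc ∫⁻ x, ‖x - y‖ₑ ^ (-s) * F x
      ≤ ∫⁻ x, (F x + M * (Metric.ball 0 1).indicator (fun z => ‖z‖ₑ ^ (-s)) (x - y)) := by
        refine lintegral_mono fun x => ?_
        refine (mul_le_mul_left (enorm_rpow_neg_le_one_add hs0 _) _).trans ?_
        rw [add_mul, one_mul, mul_comm M]
        gcongr
        exact hFM x
    _ = _ := by
        rw [lintegral_add_left hF, lintegral_const_mul' _ _ hM,
          lintegral_sub_right_eq_self (fun z =>
            (Metric.ball 0 1).indicator (fun z => ‖z‖ₑ ^ (-s)) z) y,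
          lintegral_indicator measurableSet_ball]

theorem exists_lintegral_rieszKernel_schwartz_le (hd : 0 < d) {s : ℝ} (hs0 : 0 ≤ s) (hs : s < d)
    (φ : 𝓢(EuclideanSpace ℝ (Fin d), ℂ)) :
    ∃ B : ℝ≥0∞, B ≠ ⊤ ∧ ∀ y, ∫⁻ x, ‖x - y‖ₑ ^ (-s) * ‖φ x‖ₑ ≤ B := by
  obtain ⟨C, hC⟩ := φ.decay 0 0
  refine exists_lintegral_rieszKernel_le hd hs0 hs (by fun_prop) (M := ENNReal.ofReal C)
    ENNReal.ofReal_ne_top (fun x => ?_) φ.integrable.hasFiniteIntegral.ne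
  rw [← ofReal_norm]
  exact ENNReal.ofReal_le_ofReal (by simpa using hC.2 x)

theorem integrable_rieszKernel_mul_schwartz (hd : 0 < d) {s : ℝ} (hs0 : 0 ≤ s) (hs : s < d)
    (φ : 𝓢(EuclideanSpace ℝ (Fin d), ℂ)) (y : EuclideanSpace ℝ (Fin d)) :
    Integrable (fun x => ((‖x - y‖ ^ (-s) : ℝ) : ℂ) * φ x) volume := by
  obtain ⟨B, hB, h⟩ := exists_lintegral_rieszKernel_schwartz_le hd hs0 hs φ
  refine ⟨Measurable.aestronglyMeasurable (by fun_prop), ?_⟩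
  refine lt_of_le_of_lt (le_trans (lintegral_mono_ae ?_) (h y)) hB.lt_top
  have : NeZero d := ⟨hd.ne'⟩
  have : Nontrivial (EuclideanSpace ℝ (Fin d)) := by
    apply Module.nontrivial_of_finrank_pos (R := ℝ); simpa using hd
  filter_upwards [compl_mem_ae_iff.2 (measure_singleton y)] with x hx
  have hx : x - y ≠ 0 := sub_ne_zero.2 hx
  rw [enorm_rpow_neg_eq_ofReal hx, enorm_mul, ← ofReal_norm (((‖x - y‖ ^ (-s) : ℝ) : ℂ)),
    Complex.norm_real, Real.norm_of_nonneg (by positivity)]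

end RieszKernel

/-! ### Fourier transform of the Riesz kernel by Gaussian subordination. -/

section Subordination

/-- Interchange of integrals for a kernel which is a superposition of nonnegative kernels. -/
theorem integral_mul_eq_integral_integral_mul {X S : Type*} [MeasurableSpace X] [MeasurableSpace S]
    {μ : Measure X} {ν : Measure S} [SFinite μ] [SFinite ν] {h : S → X → ℝ} {H : X → ℝ} {F : X → ℂ}
    (hm : Measurable (Function.uncurry h)) (h0 : ∀ᵐ s ∂ν, ∀ x, 0 ≤ h s x) (hF : Measurable F)
    (hH : ∀ᵐ x ∂μ, Integrable (fun s => h s x) ν ∧ ∫ s, h s x ∂ν = H x)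
    (hi : Integrable (fun x => (H x : ℂ) * F x) μ) :
    ∫ x, (H x : ℂ) * F x ∂μ = ∫ s, ∫ x, (h s x : ℂ) * F x ∂μ ∂ν := by
  -- Since `h` is nonnegative, integrating the norm in `s` gives exactly H|F|, so `hi` is the
  -- Tonelli condition.
  have hint : Integrable (Function.uncurry fun x s => (h s x : ℂ) * F x) (μ.prod ν) := by
    have hm' : Measurable (Function.uncurry fun x s => (h s x : ℂ) * F x) :=
      (Complex.measurable_ofReal.comp (hm.comp measurable_swap)).mul (hF.comp measurable_fst)
    rw [integrable_prod_iff hm'.aestronglyMeasurable]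
    constructor
    · filter_upwards [hH] with x hx
      exact (hx.1.ofReal (𝕜 := ℂ)).mul_const (F x)
    · refine hi.norm.congr ?_
      filter_upwards [hH] with x hx
      have : ∀ᵐ s ∂ν, ‖(h s x : ℂ) * F x‖ = h s x * ‖F x‖ := by
        filter_upwards [h0] with s hs
        rw [norm_mul, Complex.norm_real, Real.norm_of_nonneg (hs x)]
      have hp : 0 ≤ H x := by
        rw [← hx.2]
        exact integral_nonneg_of_ae (h0.mono fun s hs => hs x)
      simp only [Function.uncurry]
      rw [integral_congr_ae this, integral_mul_const, hx.2, norm_mul, Complex.norm_real,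
        Real.norm_of_nonneg hp]
  rw [← integral_integral_swap hint]
  refine integral_congr_ae ?_
  filter_upwards [hH] with x hx
  rw [integral_mul_const, ← hx.2, integral_complex_ofReal]

/-- A non-integrable function has integral 0 by convention, but the Gamma formula gives a positive
value. -/
theorem integrableOn_rpow_mul_exp_neg_mul {a b : ℝ} (ha : 0 < a) (hb : 0 < b) :
    IntegrableOn (fun t : ℝ => t ^ (a - 1) * Real.exp (-(b * t))) (Set.Ioi 0) := by
  by_contra h
  have h1 := Real.integral_rpow_mul_exp_neg_mul_Ioi ha hb
  rw [integral_undef h] at h1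
  have := Real.Gamma_pos_of_pos ha
  have h2 : 0 < (1 / b) ^ a := by positivity
  nlinarith [mul_pos h2 this]

/-- The substitution t ↦ 1/t reduces this to the Gamma integral; integrability again follows from
the value being nonzero. -/
theorem integral_rpow_mul_exp_neg_div {a b : ℝ} (ha : 0 < a) (hb : 0 < b) :
    IntegrableOn (fun t : ℝ => t ^ (-a - 1) * Real.exp (-(b / t))) (Set.Ioi 0) ∧
    ∫ t in Set.Ioi (0 : ℝ), t ^ (-a - 1) * Real.exp (-(b / t)) = (1 / b) ^ a * Real.Gamma a := by
  have key : ∫ t in Set.Ioi (0 : ℝ), t ^ (-a - 1) * Real.exp (-(b / t)) =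
      (1 / b) ^ a * Real.Gamma a := by
    rw [← Real.integral_rpow_mul_exp_neg_mul_Ioi ha hb,
      ← integral_comp_rpow_Ioi _ (p := -1) (by norm_num)]
    refine setIntegral_congr_fun measurableSet_Ioi fun t ht => ?_
    have ht : 0 < t := ht
    simp only [abs_neg, abs_one, one_mul, smul_eq_mul]
    rw [← Real.rpow_mul ht.le, ← mul_assoc, ← Real.rpow_add ht, Real.rpow_neg_one, div_eq_mul_inv, inv_inv]
    congr 2; ring
  refine ⟨?_, key⟩
  by_contra h
  rw [integral_undef h] at key
  have := Real.Gamma_pos_of_pos ha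
  have h2 : 0 < (1 / b) ^ a := by positivity
  nlinarith [mul_pos h2 this]

variable {d : ℕ}

theorem fourier_translated_gaussian {s : ℝ} (hs : 0 < s) (y ξ : EuclideanSpace ℝ (Fin d)) :
    𝓕 (fun x : EuclideanSpace ℝ (Fin d) => ((Real.exp (-(Real.pi * s * ‖x - y‖ ^ 2)) : ℝ) : ℂ)) ξ =
      ((s ^ (-((d : ℝ) / 2)) * Real.exp (-(Real.pi * ‖ξ‖ ^ 2 / s)) : ℝ) : ℂ) *
        Complex.exp (((-2 * Real.pi * inner ℝ y ξ : ℝ) : ℂ) * Complex.I) := by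
  have hb : 0 < ((Real.pi * s : ℝ) : ℂ).re := by
    rw [Complex.ofReal_re]; positivity
  have h1 := fourier_gaussian_innerProductSpace (V := EuclideanSpace ℝ (Fin d)) hb ξ
  have h2 := VectorFourier.fourierIntegral_comp_add_right Real.fourierChar
    (volume : Measure (EuclideanSpace ℝ (Fin d))) (innerₗ (EuclideanSpace ℝ (Fin d)))
    (fun v => Complex.exp (-((Real.pi * s : ℝ) : ℂ) * (‖v‖ : ℂ) ^ 2)) (-y)
  have h3 : (fun x : EuclideanSpace ℝ (Fin d) =>
      ((Real.exp (-(Real.pi * s * ‖x - y‖ ^ 2)) : ℝ) : ℂ)) =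
      (fun v => Complex.exp (-((Real.pi * s : ℝ) : ℂ) * (‖v‖ : ℂ) ^ 2)) ∘ fun v => v + -y := by
    ext x
    simp [sub_eq_add_neg]
  rw [h3]
  change VectorFourier.fourierIntegral _ _ _ _ ξ = _
  rw [h2]
  change _ • 𝓕 (fun v : EuclideanSpace ℝ (Fin d) =>
    Complex.exp (-((Real.pi * s : ℝ) : ℂ) * (‖v‖ : ℂ) ^ 2)) ξ = _
  rw [h1, Circle.smul_def, Real.fourierChar_apply, smul_eq_mul, mul_comm]
  congr 1
  · have e1 : (Real.pi : ℂ) / ((Real.pi * s : ℝ) : ℂ) = ((s⁻¹ : ℝ) : ℂ) := by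
      push_cast
      field_simp [Real.pi_ne_zero]
    have e2 : ((Module.finrank ℝ (EuclideanSpace ℝ (Fin d)) : ℂ) / 2) =
        (((d : ℝ) / 2 : ℝ) : ℂ) := by
      rw [finrank_euclideanSpace_fin]; push_cast; rfl
    rw [e1, e2, ← Complex.ofReal_cpow (by positivity), Real.inv_rpow hs.le, ← Real.rpow_neg hs.le]
    push_cast
    congr 2
    field_simp [Real.pi_ne_zero]
  · simp

theorem integral_translated_gaussian_mul_fourier {s : ℝ} (hs : 0 < s)
    (y : EuclideanSpace ℝ (Fin d)) (φ : 𝓢(EuclideanSpace ℝ (Fin d), ℂ)) :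
    ∫ x, ((Real.exp (-(Real.pi * s * ‖x - y‖ ^ 2)) : ℝ) : ℂ) * 𝓕 φ x =
      ∫ ξ, ((s ^ (-((d : ℝ) / 2)) * Real.exp (-(Real.pi * ‖ξ‖ ^ 2 / s)) : ℝ) : ℂ) *
        (Complex.exp (((-2 * Real.pi * inner ℝ y ξ : ℝ) : ℂ) * Complex.I) * φ ξ) := by
  have hg : Integrable (fun x : EuclideanSpace ℝ (Fin d) =>
      ((Real.exp (-(Real.pi * s * ‖x - y‖ ^ 2)) : ℝ) : ℂ)) volume := by
    have hb : 0 < ((Real.pi * s : ℝ) : ℂ).re := by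
      rw [Complex.ofReal_re]; positivity
    have := GaussianFourier.integrable_cexp_neg_mul_sq_norm_add hb 0 (0 : EuclideanSpace ℝ (Fin d))
    refine (this.comp_sub_right y).congr (Filter.Eventually.of_forall fun x => ?_)
    simp
  have h := VectorFourier.integral_fourierIntegral_smul_eq_flip (𝕜 := ℝ) (μ := volume)
    (ν := volume) (L := innerₗ (EuclideanSpace ℝ (Fin d))) (e := Real.fourierChar)
    Real.continuous_fourierChar continuous_inner hg φ.integrable
  rw [flip_innerₗ] at h
  have h' : ∫ ξ, 𝓕 (fun x : EuclideanSpace ℝ (Fin d) =>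
      ((Real.exp (-(Real.pi * s * ‖x - y‖ ^ 2)) : ℝ) : ℂ)) ξ • φ ξ =
      ∫ x, ((Real.exp (-(Real.pi * s * ‖x - y‖ ^ 2)) : ℝ) : ℂ) • 𝓕 (⇑φ) x := h
  simp only [smul_eq_mul] at h'
  rw [SchwartzMap.fourier_coe, ← h']
  refine integral_congr_ae (Filter.Eventually.of_forall fun ξ => ?_)
  simp only
  rw [fourier_translated_gaussian hs, mul_assoc]

/-- With β = d - α, the kernel |x-y|^{-β} is a multiple of ∫ s^{β/2-1} e^{-πs|x-y|²} ds.
Transforming each Gaussian produces a factor s^{-d/2}, and β/2 - 1 - d/2 = -α/2 - 1 is the exponent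
for which e^{-π|ξ|²/s} superposes to a multiple of |ξ|^{-α}. -/
theorem integral_rieszKernel_mul_fourier (hd : 0 < d) {α : ℝ} (hα : 0 < α) (hαd : α < d)
    (y : EuclideanSpace ℝ (Fin d)) (φ : 𝓢(EuclideanSpace ℝ (Fin d), ℂ)) :
    ∫ x, ((‖x - y‖ ^ (-((d : ℝ) - α)) : ℝ) : ℂ) * 𝓕 φ x =
      (rieszConst d α : ℂ) * ∫ ξ, (((2 * Real.pi * ‖ξ‖) ^ (-α) : ℝ) : ℂ) *
        (Complex.exp (((-2 * Real.pi * inner ℝ y ξ : ℝ) : ℂ) * Complex.I) * φ ξ) := by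
  have : NeZero d := ⟨hd.ne'⟩
  have : Nontrivial (EuclideanSpace ℝ (Fin d)) := by
    apply Module.nontrivial_of_finrank_pos (R := ℝ); simpa using hd
  have hpi := Real.pi_pos
  set β : ℝ := (d : ℝ) - α with hβ
  have hβ0 : 0 < β := by linarith
  have hGβ : 0 < Real.Gamma (β / 2) := Real.Gamma_pos_of_pos (by positivity)
  set c₁ : ℝ := Real.pi ^ (-(β / 2)) * Real.Gamma (β / 2) with hc₁
  have hc₁0 : 0 < c₁ := by positivity
  set c₂ : ℝ := Real.pi ^ (-(α / 2)) * Real.Gamma (α / 2) with hc₂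
  have hpow : ∀ (z : EuclideanSpace ℝ (Fin d)) (a : ℝ), z ≠ 0 →
      (1 / (Real.pi * ‖z‖ ^ 2)) ^ (a / 2) = Real.pi ^ (-(a / 2)) * ‖z‖ ^ (-a) := by
    intro z a hz
    have hz0 : 0 < ‖z‖ := norm_pos_iff.2 hz
    rw [one_div, Real.inv_rpow (by positivity), ← Real.rpow_neg (by positivity),
      Real.mul_rpow hpi.le (by positivity), ← Real.rpow_natCast, ← Real.rpow_mul hz0.le]
    congr 2
    push_cast; ring
  let h₁ : ℝ → EuclideanSpace ℝ (Fin d) → ℝ := fun s x =>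
    s ^ (β / 2 - 1) * Real.exp (-(Real.pi * ‖x - y‖ ^ 2 * s))
  let h₂ : ℝ → EuclideanSpace ℝ (Fin d) → ℝ := fun s ξ =>
    s ^ (-(α / 2) - 1) * Real.exp (-(Real.pi * ‖ξ‖ ^ 2 / s))
  have hpos : ∀ᵐ s ∂(volume.restrict (Set.Ioi (0 : ℝ))), 0 < s :=
    ae_restrict_mem measurableSet_Ioi
  have A : ∫ x, ((c₁ * ‖x - y‖ ^ (-β) : ℝ) : ℂ) * 𝓕 φ x =
      ∫ s in Set.Ioi (0 : ℝ), ∫ x, (h₁ s x : ℂ) * 𝓕 φ x := by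
    refine integral_mul_eq_integral_integral_mul (by fun_prop) ?_ (by fun_prop) ?_ ?_
    · filter_upwards [hpos] with s hs x
      positivity
    · filter_upwards [compl_mem_ae_iff.2 (measure_singleton y)] with x hx
      have hx : x - y ≠ 0 := sub_ne_zero.2 hx
      have hx0 : 0 < ‖x - y‖ := norm_pos_iff.2 hx
      refine ⟨integrableOn_rpow_mul_exp_neg_mul (by positivity) (by positivity), ?_⟩
      rw [Real.integral_rpow_mul_exp_neg_mul_Ioi (by positivity) (by positivity), hpow _ _ hx]
      ring
    · refine ((integrable_rieszKernel_mul_schwartz hd hβ0.le (by linarith) (𝓕 φ) y).const_mul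
        (c₁ : ℂ)).congr (Filter.Eventually.of_forall fun x => ?_)
      push_cast; ring
  have B : ∫ ξ, ((c₂ * ‖ξ‖ ^ (-α) : ℝ) : ℂ) *
        (Complex.exp (((-2 * Real.pi * inner ℝ y ξ : ℝ) : ℂ) * Complex.I) * φ ξ) =
      ∫ s in Set.Ioi (0 : ℝ), ∫ ξ, (h₂ s ξ : ℂ) *
        (Complex.exp (((-2 * Real.pi * inner ℝ y ξ : ℝ) : ℂ) * Complex.I) * φ ξ) := by
    refine integral_mul_eq_integral_integral_mul (by fun_prop) ?_ (by fun_prop) ?_ ?_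
    · filter_upwards [hpos] with s hs x
      positivity
    · filter_upwards [compl_mem_ae_iff.2
        (measure_singleton (0 : EuclideanSpace ℝ (Fin d)))] with ξ hξ
      have hξ : ξ ≠ 0 := hξ
      have hξ0 : 0 < ‖ξ‖ := norm_pos_iff.2 hξ
      have := integral_rpow_mul_exp_neg_div (a := α / 2) (b := Real.pi * ‖ξ‖ ^ 2) (by positivity)
        (by positivity)
      refine ⟨this.1, ?_⟩
      rw [this.2, hpow _ _ hξ]
      ring
    · have h := (integrable_rieszKernel_mul_schwartz hd hα.le hαd φ 0).const_mul (c₂ : ℂ)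
      refine (h.mul_bdd (c := 1) (g := fun ξ => Complex.exp (((-2 * Real.pi * inner ℝ y ξ : ℝ) : ℂ)
        * Complex.I)) (Continuous.aestronglyMeasurable (by fun_prop))
        (Filter.Eventually.of_forall fun ξ => ?_)).congr (Filter.Eventually.of_forall fun ξ => ?_)
      · rw [Complex.norm_exp_ofReal_mul_I]
      · simp only [sub_zero]
        push_cast; ring
  have AB : ∫ s in Set.Ioi (0 : ℝ), ∫ x, (h₁ s x : ℂ) * 𝓕 φ x =
      ∫ s in Set.Ioi (0 : ℝ), ∫ ξ, (h₂ s ξ : ℂ) *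
        (Complex.exp (((-2 * Real.pi * inner ℝ y ξ : ℝ) : ℂ) * Complex.I) * φ ξ) := by
    refine setIntegral_congr_fun measurableSet_Ioi fun s hs => ?_
    have hs : 0 < s := hs
    have e := integral_translated_gaussian_mul_fourier hs y φ
    have e1 : ∀ x, (h₁ s x : ℂ) * 𝓕 φ x = ((s ^ (β / 2 - 1) : ℝ) : ℂ) *
        (((Real.exp (-(Real.pi * s * ‖x - y‖ ^ 2)) : ℝ) : ℂ) * 𝓕 φ x) := by
      intro x
      have : Real.pi * ‖x - y‖ ^ 2 * s = Real.pi * s * ‖x - y‖ ^ 2 := by ring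
      simp only [h₁, this]
      push_cast; ring
    simp only [e1]
    rw [integral_const_mul, e, ← integral_const_mul]
    refine integral_congr_ae (Filter.Eventually.of_forall fun ξ => ?_)
    simp only [h₂]
    rw [← mul_assoc, ← Complex.ofReal_mul, ← mul_assoc (s ^ (β / 2 - 1)), ← Real.rpow_add hs]
    congr 4
    rw [hβ]; ring
  rw [← AB, ← A] at B
  have hA : ∫ x, ((c₁ * ‖x - y‖ ^ (-β) : ℝ) : ℂ) * 𝓕 φ x =
      (c₁ : ℂ) * ∫ x, ((‖x - y‖ ^ (-β) : ℝ) : ℂ) * 𝓕 φ x := by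
    rw [← integral_const_mul]
    refine integral_congr_ae (Filter.Eventually.of_forall fun ξ => ?_)
    push_cast; ring
  rw [hA] at B
  -- This identity fixes the normalization: c₂/c₁ = γ(α)(2π)^{-α}.
  have hconst : ∀ r : ℝ, 0 ≤ r → c₂ * r ^ (-α) = c₁ * (rieszConst d α * (2 * Real.pi * r) ^ (-α)) := by
    intro r hr
    have h1 : Real.pi ^ (-(α / 2)) =
        Real.pi ^ (-(β / 2)) * Real.pi ^ ((d : ℝ) / 2) * Real.pi ^ (-α) := by
      rw [← Real.rpow_add hpi, ← Real.rpow_add hpi]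
      congr 1
      rw [hβ]; ring
    have h2 : (2 : ℝ) ^ α * 2 ^ (-α) = 1 := by
      rw [← Real.rpow_add two_pos]; simp
    rw [Real.mul_rpow (by positivity) hr, Real.mul_rpow two_pos.le hpi.le, hc₁, hc₂, h1, rieszConst,
      ← hβ]
    field_simp
    linear_combination (-r ^ (-α)) * h2
  have hc₁' : (c₁ : ℂ) ≠ 0 := by exact_mod_cast hc₁0.ne'
  apply mul_left_cancel₀ hc₁'
  rw [← B, ← integral_const_mul, ← integral_const_mul]
  refine integral_congr_ae (Filter.Eventually.of_forall fun ξ => ?_)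
  simp only
  rw [hconst _ (norm_nonneg ξ)]
  push_cast; ring

end Subordination

/-! ### The Riesz potential of a finite measure and its Fourier transform. -/

section RieszPotential

variable {d : ℕ} {μ : Measure (EuclideanSpace ℝ (Fin d))} {α : ℝ}

theorem rieszConst_pos (hα : 0 < α) (hαd : α < d) : 0 < rieszConst d α := by
  have h1 : 0 < Real.Gamma (α / 2) := Real.Gamma_pos_of_pos (by positivity)
  have h2 : 0 < Real.Gamma (((d : ℝ) - α) / 2) := Real.Gamma_pos_of_pos (by linarith)
  have := Real.pi_pos
  unfold rieszConst
  positivity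

theorem measurable_rieszPotential [SFinite μ] : Measurable (rieszPotential α μ) := by
  unfold rieszPotential
  exact (Measurable.lintegral_prod_right' (f := fun p : EuclideanSpace ℝ (Fin d) ×
    EuclideanSpace ℝ (Fin d) => ‖p.1 - p.2‖ₑ ^ (α - (d : ℝ))) (by fun_prop)).const_mul _

theorem lintegral_rieszPotential_mul [SFinite μ] {F : EuclideanSpace ℝ (Fin d) → ℝ≥0∞}
    (hF : Measurable F) :
    ∫⁻ x, rieszPotential α μ x * F x =
      (ENNReal.ofReal (rieszConst d α))⁻¹ * ∫⁻ y, (∫⁻ x, ‖x - y‖ₑ ^ (α - (d : ℝ)) * F x) ∂μ := by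
  unfold rieszPotential
  have hm : Measurable fun x : EuclideanSpace ℝ (Fin d) => ∫⁻ y, ‖x - y‖ₑ ^ (α - (d : ℝ)) ∂μ :=
    Measurable.lintegral_prod_right' (f := fun p : EuclideanSpace ℝ (Fin d) ×
      EuclideanSpace ℝ (Fin d) => ‖p.1 - p.2‖ₑ ^ (α - (d : ℝ))) (by fun_prop)
  simp_rw [mul_assoc]
  rw [lintegral_const_mul _ (by fun_prop)]
  congr 1
  rw [lintegral_lintegral_swap (by fun_prop)]
  refine lintegral_congr fun x => ?_
  rw [lintegral_mul_const _ (by fun_prop)]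

theorem lintegral_rieszPotential_mul_lt_top [IsFiniteMeasure μ] (hα : 0 < α) (hαd : α < d)
    {F : EuclideanSpace ℝ (Fin d) → ℝ≥0∞} (hF : Measurable F) {M : ℝ≥0∞} (hM : M ≠ ⊤)
    (hFM : ∀ x, F x ≤ M) (hFi : ∫⁻ x, F x ≠ ⊤) :
    ∫⁻ x, rieszPotential α μ x * F x < ⊤ := by
  have hd : 0 < d := by exact_mod_cast hα.trans hαd
  obtain ⟨B, hB, h⟩ := exists_lintegral_rieszKernel_le hd (s := d - α) (by linarith) (by linarith)
    hF hM hFM hFi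
  rw [lintegral_rieszPotential_mul hF]
  refine ENNReal.mul_lt_top (ENNReal.inv_lt_top.2
    (ENNReal.ofReal_pos.2 (rieszConst_pos hα hαd))) ?_
  simp only [neg_sub] at h
  refine (lintegral_mono h).trans_lt ?_
  rw [lintegral_const]
  exact ENNReal.mul_lt_top hB.lt_top (measure_lt_top _ _)

/-- The potential has finite integral against the bounded, integrable, strictly positive weight
(1+|x|)^{-(d+1)}. -/
theorem ae_rieszPotential_lt_top [IsFiniteMeasure μ] (hα : 0 < α) (hαd : α < d) :
    ∀ᵐ x, rieszPotential α μ x < ⊤ := by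
  have h1 := integrable_one_add_norm (E := EuclideanSpace ℝ (Fin d)) (μ := volume)
    (r := (d : ℝ) + 1) (by simp)
  let F : EuclideanSpace ℝ (Fin d) → ℝ≥0∞ :=
    fun x => ENNReal.ofReal ((1 + ‖x‖) ^ (-((d : ℝ) + 1)))
  have hF : Measurable F := by fun_prop
  have h := lintegral_rieszPotential_mul_lt_top (μ := μ) hα hαd hF (M := 1) ENNReal.one_ne_top
    (fun x => by
      rw [← ENNReal.ofReal_one]
      refine ENNReal.ofReal_le_ofReal (Real.rpow_le_one_of_one_le_of_nonpos ?_ ?_)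
      · linarith [norm_nonneg x]
      · linarith [(Nat.cast_nonneg d : (0 : ℝ) ≤ d)])
    (by
      have := h1.hasFiniteIntegral.ne
      convert this using 3 with x
      rw [Real.enorm_of_nonneg (by positivity)])
  filter_upwards [ae_lt_top (measurable_rieszPotential.mul hF) h.ne] with x hx
  by_contra hc
  rw [not_lt, top_le_iff] at hc
  simp only [Pi.mul_apply, hc] at hx
  rw [ENNReal.top_mul (by simp only [F, ne_eq, ENNReal.ofReal_eq_zero, not_le]; positivity)] at hx
  exact lt_irrefl _ hx

theorem toReal_rieszPotential_eq [IsFiniteMeasure μ] (hα : 0 < α) (hαd : α < d) :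
    ∀ᵐ x, (rieszPotential α μ x).toReal =
      (rieszConst d α)⁻¹ * ∫ y, ‖x - y‖ ^ (-((d : ℝ) - α)) ∂μ := by
  have hc := rieszConst_pos hα hαd
  filter_upwards [ae_rieszPotential_lt_top (μ := μ) hα hαd] with x hx
  unfold rieszPotential at hx ⊢
  have hi : ∫⁻ y, ‖x - y‖ₑ ^ (α - (d : ℝ)) ∂μ ≠ ⊤ := by
    intro h
    rw [h, ENNReal.mul_top (by simp)] at hx
    exact lt_irrefl _ hx
  rw [ENNReal.toReal_mul, ENNReal.toReal_inv, ENNReal.toReal_ofReal hc.le,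
    ← integral_toReal (by fun_prop) (ae_lt_top' (by fun_prop) hi)]
  -- The conventions agree at y = x: `⊤.toReal` and the real power of 0 with a negative exponent are
  -- both 0.
  simp [← ENNReal.toReal_rpow, neg_sub]

/-- The Fourier transform `∫ exp (-2πi ⟪y, ξ⟫) dμ(y)` of a measure. -/
noncomputable def measureFourier (μ : Measure (EuclideanSpace ℝ (Fin d)))
    (ξ : EuclideanSpace ℝ (Fin d)) : ℂ :=
  ∫ y, Complex.exp (((-2 * Real.pi * inner ℝ y ξ : ℝ) : ℂ) * Complex.I) ∂μ

/-- The Fourier transform `(2π|ξ|)^{-α} μ̂(ξ)` of the Riesz potential of `μ`. -/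
noncomputable def rieszFourier (α : ℝ) (μ : Measure (EuclideanSpace ℝ (Fin d)))
    (ξ : EuclideanSpace ℝ (Fin d)) : ℂ :=
  (((2 * Real.pi * ‖ξ‖) ^ (-α) : ℝ) : ℂ) * measureFourier μ ξ

theorem measurable_measureFourier [SFinite μ] : Measurable (measureFourier μ) := by
  unfold measureFourier
  refine (StronglyMeasurable.integral_prod_right' (f := fun p : EuclideanSpace ℝ (Fin d) ×
    EuclideanSpace ℝ (Fin d) =>
      Complex.exp (((-2 * Real.pi * inner ℝ p.2 p.1 : ℝ) : ℂ) * Complex.I)) ?_).measurable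
  exact Continuous.stronglyMeasurable (by fun_prop)

theorem norm_measureFourier_le [IsFiniteMeasure μ] (ξ : EuclideanSpace ℝ (Fin d)) :
    ‖measureFourier μ ξ‖ ≤ μ.real Set.univ := by
  refine (norm_integral_le_integral_norm _).trans (le_of_eq ?_)
  simp_rw [Complex.norm_exp_ofReal_mul_I]
  simp

theorem integrable_rieszFourier_mul_schwartz [IsFiniteMeasure μ] (hα : 0 < α) (hαd : α < d)
    (φ : 𝓢(EuclideanSpace ℝ (Fin d), ℂ)) :
    Integrable (fun ξ => rieszFourier α μ ξ * φ ξ) volume := by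
  have hd : 0 < d := by exact_mod_cast hα.trans hαd
  have h := (integrable_rieszKernel_mul_schwartz hd hα.le hαd φ 0).const_mul
    (((2 * Real.pi) ^ (-α) : ℝ) : ℂ)
  refine (h.mul_bdd (c := μ.real Set.univ) (g := measureFourier μ)
    measurable_measureFourier.aestronglyMeasurable
    (Filter.Eventually.of_forall norm_measureFourier_le)).congr
    (Filter.Eventually.of_forall fun ξ => ?_)
  simp only [sub_zero, rieszFourier]
  rw [Real.mul_rpow (by positivity) (norm_nonneg ξ)]
  push_cast; ring

/-- The kernel identity at each fixed `y` is integrated against μ, with Fubini on both sides. Fubini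
applies because the kernel integrals are bounded uniformly in `y` and μ is finite. -/
theorem hasDistribFourierTransform_rieszPotential [IsFiniteMeasure μ] (hα : 0 < α) (hαd : α < d) :
    HasDistribFourierTransform (fun x => ((rieszPotential α μ x).toReal : ℂ))
      (rieszFourier α μ) := by
  have hd : 0 < d := by exact_mod_cast hα.trans hαd
  have hc := rieszConst_pos hα hαd
  have hcC : (rieszConst d α : ℂ) ≠ 0 := by exact_mod_cast hc.ne'
  refine ⟨fun φ => ?_, integrable_rieszFourier_mul_schwartz hα hαd, fun φ => ?_⟩
  · obtain ⟨C, hC⟩ := φ.decay 0 0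
    refine ⟨((Complex.measurable_ofReal.comp measurable_rieszPotential.ennreal_toReal).mul
      φ.continuous.measurable).aestronglyMeasurable, ?_⟩
    have h := lintegral_rieszPotential_mul_lt_top (μ := μ) hα hαd (F := fun x => ‖φ x‖ₑ)
      (by fun_prop) (M := ENNReal.ofReal C) ENNReal.ofReal_ne_top (fun x => by
        rw [← ofReal_norm]
        exact ENNReal.ofReal_le_ofReal (by simpa using hC.2 x)) φ.integrable.hasFiniteIntegral.ne
    refine lt_of_le_of_lt (lintegral_mono fun x => ?_) h
    rw [enorm_mul]
    gcongr
    rw [← ofReal_norm, Complex.norm_real, Real.norm_of_nonneg ENNReal.toReal_nonneg]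
    exact ENNReal.ofReal_toReal_le
  · have hint : Integrable (Function.uncurry fun (y x : EuclideanSpace ℝ (Fin d)) =>
        ((‖x - y‖ ^ (-((d : ℝ) - α)) : ℝ) : ℂ) * 𝓕 φ x) (μ.prod volume) := by
      obtain ⟨B, hB, h⟩ := exists_lintegral_rieszKernel_schwartz_le hd (s := d - α) (by linarith)
        (by linarith) (𝓕 φ)
      refine ⟨Measurable.aestronglyMeasurable (by fun_prop), ?_⟩
      rw [HasFiniteIntegral, lintegral_prod _ (Measurable.aemeasurable (Measurable.enorm (by fun_prop)))]
      refine lt_of_le_of_lt (lintegral_mono fun y => (lintegral_mono_ae ?_).trans (h y)) ?_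
      · have : NeZero d := ⟨hd.ne'⟩
        have : Nontrivial (EuclideanSpace ℝ (Fin d)) := by
          apply Module.nontrivial_of_finrank_pos (R := ℝ); simpa using hd
        filter_upwards [compl_mem_ae_iff.2 (measure_singleton y)] with x hx
        have hx : x - y ≠ 0 := sub_ne_zero.2 hx
        simp only [Function.uncurry]
        rw [enorm_rpow_neg_eq_ofReal hx, enorm_mul, ← ofReal_norm, Complex.norm_real,
          Real.norm_of_nonneg (by positivity)]
      · rw [lintegral_const]
        exact ENNReal.mul_lt_top hB.lt_top (measure_lt_top _ _)
    have hint' : Integrable (Function.uncurry fun (y ξ : EuclideanSpace ℝ (Fin d)) =>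
        (((2 * Real.pi * ‖ξ‖) ^ (-α) : ℝ) : ℂ) *
        (Complex.exp (((-2 * Real.pi * inner ℝ y ξ : ℝ) : ℂ) * Complex.I) * φ ξ))
        (μ.prod volume) := by
      have h := (integrable_rieszKernel_mul_schwartz hd hα.le hαd φ 0).const_mul
        (((2 * Real.pi) ^ (-α) : ℝ) : ℂ)
      have h2 := h.comp_snd μ
      refine (h2.mul_bdd (c := 1) (g := fun p : EuclideanSpace ℝ (Fin d) ×
        EuclideanSpace ℝ (Fin d) =>
        Complex.exp (((-2 * Real.pi * inner ℝ p.1 p.2 : ℝ) : ℂ) * Complex.I))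
        (Continuous.aestronglyMeasurable (by fun_prop))
        (Filter.Eventually.of_forall fun p => ?_)).congr (Filter.Eventually.of_forall fun p => ?_)
      · rw [Complex.norm_exp_ofReal_mul_I]
      · simp only [sub_zero, Function.uncurry]
        rw [Real.mul_rpow (by positivity) (norm_nonneg _)]
        push_cast; ring
    calc ∫ x, ((rieszPotential α μ x).toReal : ℂ) * 𝓕 φ x
        = ∫ x, (rieszConst d α : ℂ)⁻¹ *
            ∫ y, ((‖x - y‖ ^ (-((d : ℝ) - α)) : ℝ) : ℂ) * 𝓕 φ x ∂μ := by
          refine integral_congr_ae ?_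
          filter_upwards [toReal_rieszPotential_eq (μ := μ) hα hαd] with x hx
          rw [hx, integral_mul_const, integral_complex_ofReal]
          push_cast; ring
      _ = (rieszConst d α : ℂ)⁻¹ *
            ∫ y, (∫ x, ((‖x - y‖ ^ (-((d : ℝ) - α)) : ℝ) : ℂ) * 𝓕 φ x) ∂μ := by
          rw [integral_const_mul, integral_integral_swap hint]
      _ = ∫ y, (∫ ξ, (((2 * Real.pi * ‖ξ‖) ^ (-α) : ℝ) : ℂ) *
        (Complex.exp (((-2 * Real.pi * inner ℝ y ξ : ℝ) : ℂ) * Complex.I) * φ ξ)) ∂μ := by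
          simp_rw [integral_rieszKernel_mul_fourier hd hα hαd]
          rw [integral_const_mul, ← mul_assoc, inv_mul_cancel₀ hcC, one_mul]
      _ = ∫ ξ, rieszFourier α μ ξ * φ ξ := by
          rw [integral_integral_swap hint']
          refine integral_congr_ae (Filter.Eventually.of_forall fun ξ => ?_)
          simp only [rieszFourier, measureFourier]
          rw [integral_const_mul, integral_mul_const, ← mul_assoc]

end RieszPotential

/-! ### Uniqueness of the function representing the Fourier transform. -/

section Uniqueness

variable {d : ℕ}

/-- Test with a smooth bump equal to 1 on a unit ball. -/
theorem locallyIntegrable_of_integrable_mul_schwartz {g : EuclideanSpace ℝ (Fin d) → ℂ}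
    (hg : ∀ φ : 𝓢(EuclideanSpace ℝ (Fin d), ℂ), Integrable (fun ξ => g ξ * φ ξ) volume) :
    LocallyIntegrable g volume := by
  intro x
  let b : ContDiffBump x := ⟨1, 2, one_pos, one_lt_two⟩
  have hs : HasCompactSupport (fun y => ((b y : ℝ) : ℂ)) :=
    b.hasCompactSupport.comp_left Complex.ofReal_zero
  have hd : ContDiff ℝ ((⊤ : ℕ∞) : WithTop ℕ∞) (fun y => ((b y : ℝ) : ℂ)) :=
    Complex.ofRealCLM.contDiff.comp b.contDiff
  refine ⟨Metric.closedBall x 1, Metric.closedBall_mem_nhds x one_pos, ?_⟩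
  have h := (hg (hs.toSchwartzMap hd)).integrableOn (s := Metric.closedBall x 1)
  refine h.congr_fun (fun y hy => ?_) measurableSet_closedBall
  have : b y = 1 := b.one_of_mem_closedBall hy
  simp [this]

theorem HasDistribFourierTransform.ae_eq {f g g' : EuclideanSpace ℝ (Fin d) → ℂ}
    (h : HasDistribFourierTransform f g) (h' : HasDistribFourierTransform f g') :
    g =ᵐ[volume] g' := by
  refine ae_eq_of_integral_contDiff_smul_eq
    (locallyIntegrable_of_integrable_mul_schwartz h.integrable_right)
    (locallyIntegrable_of_integrable_mul_schwartz h'.integrable_right) fun φ hφ hφs => ?_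
  have hs : HasCompactSupport (fun y => ((φ y : ℝ) : ℂ)) := hφs.comp_left Complex.ofReal_zero
  have hd : ContDiff ℝ ((⊤ : ℕ∞) : WithTop ℕ∞) (fun y => ((φ y : ℝ) : ℂ)) :=
    Complex.ofRealCLM.contDiff.comp hφ
  have e := (h.integral_eq (hs.toSchwartzMap hd)).symm.trans (h'.integral_eq (hs.toSchwartzMap hd))
  simpa [Complex.real_smul, mul_comm] using e

end Uniqueness

/-! ### Lower bounds for solutions of a perturbed oscillator equation. -/

section Oscillation

variable {u v : ℝ → ℝ} {m w r₀ : ℝ}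

/-- The energy of a solution of `u'' = (m / r² - w²) u` stays between two positive constants. -/
theorem exists_energy_bounds (hw : 0 < w) (hu : ∀ r, 0 < r → HasDerivAt u (v r) r)
    (hv : ∀ r, 0 < r → HasDerivAt v ((m / r ^ 2 - w ^ 2) * u r) r) (hr₀ : 0 < r₀)
    (h0 : u r₀ ≠ 0) :
    ∃ c C : ℝ, 0 < c ∧ 0 < C ∧ ∀ r, r₀ ≤ r →
      c ≤ v r ^ 2 + w ^ 2 * u r ^ 2 ∧ v r ^ 2 + w ^ 2 * u r ^ 2 ≤ C := by
  set E : ℝ → ℝ := fun r => v r ^ 2 + w ^ 2 * u r ^ 2 with hE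
  set A : ℝ := |m| / w with hA
  have hA0 : 0 ≤ A := by positivity
  have hE0 : ∀ r, 0 ≤ E r := fun r => by positivity
  have hEr₀ : 0 < E r₀ := by
    have : 0 < u r₀ ^ 2 := by positivity
    have h2 : 0 < w ^ 2 * u r₀ ^ 2 := by positivity
    have h3 := sq_nonneg (v r₀)
    simp only [hE]; linarith
  have hdE : ∀ r, 0 < r → HasDerivAt E (2 * (m / r ^ 2) * (u r * v r)) r := by
    intro r hr
    refine (((hv r hr).pow 2).add (((hu r hr).pow 2).const_mul (w ^ 2))).congr_deriv ?_
    push_cast; ring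
  have hbd : ∀ r, 0 < r → |2 * (m / r ^ 2) * (u r * v r)| ≤ A / r ^ 2 * E r := by
    intro r hr
    have h1 : |u r * v r| * (2 * w) ≤ E r := by
      rw [abs_mul]
      have := sq_nonneg (|v r| - w * |u r|)
      have e1 := sq_abs (v r)
      have e2 := sq_abs (u r)
      simp only [hE]; nlinarith
    rw [abs_mul, abs_mul, abs_div, abs_two, abs_of_pos (pow_pos hr 2), hA]
    have h2 : |u r * v r| ≤ E r / (2 * w) := by
      rw [le_div_iff₀ (by positivity)]; exact h1
    calc 2 * (|m| / r ^ 2) * |u r * v r| ≤ 2 * (|m| / r ^ 2) * (E r / (2 * w)) := by gcongr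
      _ = |m| / w / r ^ 2 * E r := by field_simp
  have hdexp : ∀ (a r : ℝ), 0 < r →
      HasDerivAt (fun r => Real.exp (a / r)) (Real.exp (a / r) * (-a / r ^ 2)) r := by
    intro a r hr
    simp only [div_eq_mul_inv]
    refine ((hasDerivAt_inv hr.ne').const_mul a).exp.congr_deriv ?_
    ring
  -- Grönwall with the integrable rate A/r², from |E'| ≤ (A/r²)E: the factors e^{∓A/r} make E
  -- increasing, respectively decreasing, and both tend to 1 at infinity.
  have hmono : MonotoneOn (fun r => E r * Real.exp (-A / r)) (Set.Ioi 0) := by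
    refine monotoneOn_of_hasDerivWithinAt_nonneg (convex_Ioi 0) (fun r hr =>
      ((hdE r hr).mul (hdexp (-A) r hr)).continuousAt.continuousWithinAt) (fun r hr => ?_)
      (fun r hr => ?_) (f' := fun r => 2 * (m / r ^ 2) * (u r * v r) * Real.exp (-A / r) +
        E r * (Real.exp (-A / r) * (- -A / r ^ 2)))
    · rw [interior_Ioi] at hr
      exact ((hdE r hr).mul (hdexp (-A) r hr)).hasDerivWithinAt
    · rw [interior_Ioi] at hr
      have h1 := (abs_le.1 (hbd r hr)).1
      have : 2 * (m / r ^ 2) * (u r * v r) * Real.exp (-A / r) +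
        E r * (Real.exp (-A / r) * (- -A / r ^ 2)) =
        (2 * (m / r ^ 2) * (u r * v r) + A / r ^ 2 * E r) * Real.exp (-A / r) := by ring
      rw [this]
      exact mul_nonneg (by linarith) (Real.exp_pos _).le
  have hanti : AntitoneOn (fun r => E r * Real.exp (A / r)) (Set.Ioi 0) := by
    refine antitoneOn_of_hasDerivWithinAt_nonpos (convex_Ioi 0) (fun r hr =>
      ((hdE r hr).mul (hdexp A r hr)).continuousAt.continuousWithinAt) (fun r hr => ?_)
      (fun r hr => ?_) (f' := fun r => 2 * (m / r ^ 2) * (u r * v r) * Real.exp (A / r) +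
        E r * (Real.exp (A / r) * (-A / r ^ 2)))
    · rw [interior_Ioi] at hr
      exact ((hdE r hr).mul (hdexp A r hr)).hasDerivWithinAt
    · rw [interior_Ioi] at hr
      have h1 := (abs_le.1 (hbd r hr)).2
      have : 2 * (m / r ^ 2) * (u r * v r) * Real.exp (A / r) +
        E r * (Real.exp (A / r) * (-A / r ^ 2)) =
        (2 * (m / r ^ 2) * (u r * v r) - A / r ^ 2 * E r) * Real.exp (A / r) := by ring
      rw [this]
      exact mul_nonpos_of_nonpos_of_nonneg (by linarith) (Real.exp_pos _).le
  refine ⟨E r₀ * Real.exp (-A / r₀), E r₀ * Real.exp (A / r₀), by positivity, by positivity,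
    fun r hr => ?_⟩
  have hr0 : 0 < r := hr₀.trans_le hr
  constructor
  · refine (hmono hr₀ hr0 hr).trans ?_
    have : Real.exp (-A / r) ≤ 1 := by
      rw [Real.exp_le_one_iff, neg_div]
      have : 0 ≤ A / r := by positivity
      linarith
    exact mul_le_of_le_one_right (hE0 r) this
  · refine le_trans ?_ (hanti hr₀ hr0 hr)
    have : 1 ≤ Real.exp (A / r) := Real.one_le_exp (by positivity)
    exact le_mul_of_one_le_right (hE0 r) this

/-- A nontrivial solution of `u'' = (m / r² - w²) u` is bounded below on a positive proportion of
each interval `[R, 2R]`. -/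
theorem exists_volume_lower_bound (hw : 0 < w) (hu : ∀ r, 0 < r → HasDerivAt u (v r) r)
    (hv : ∀ r, 0 < r → HasDerivAt v ((m / r ^ 2 - w ^ 2) * u r) r) (hr₀ : 0 < r₀)
    (h0 : u r₀ ≠ 0) :
    ∃ η δ R₀ : ℝ, 0 < η ∧ 0 < δ ∧ 0 < R₀ ∧ ∀ R, R₀ ≤ R →
      ENNReal.ofReal (δ * R) ≤ volume {r | r ∈ Set.Icc R (2 * R) ∧ η ≤ |u r|} := by
  obtain ⟨c, C, hc, hC, hE⟩ := exists_energy_bounds hw hu hv hr₀ h0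
  set M : ℝ := |m| * C / w ^ 2 with hM
  have hM0 : 0 ≤ M := by positivity
  have hu2 : ∀ r, r₀ ≤ r → u r ^ 2 ≤ C / w ^ 2 := by
    intro r hr
    rw [le_div_iff₀ (by positivity)]
    nlinarith [(hE r hr).2, sq_nonneg (v r)]
  have huv : ∀ r, r₀ ≤ r → |u r * v r| ≤ C / (2 * w) := by
    intro r hr
    rw [le_div_iff₀ (by positivity), abs_mul]
    have := sq_nonneg (|v r| - w * |u r|)
    have e1 := sq_abs (v r)
    have e2 := sq_abs (u r)
    nlinarith [(hE r hr).2]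
  -- Chosen so that 2w²η²R = cR/4 is half of the lower bound cR/2 for 2w²∫u²; the other half must
  -- come from the set where |u| ≥ η.
  set η : ℝ := √(c / (8 * w ^ 2)) with hη
  have hη2 : η ^ 2 = c / (8 * w ^ 2) := Real.sq_sqrt (by positivity)
  have hη0 : 0 < η := Real.sqrt_pos.2 (by positivity)
  refine ⟨η, c / (8 * C), max (max r₀ 1) ((C / w + M) * 2 / c), hη0, by positivity,
    lt_max_of_lt_left (lt_max_of_lt_left hr₀), fun R hR => ?_⟩
  have hRr : r₀ ≤ R := (le_max_left _ _).trans ((le_max_left _ _).trans hR)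
  have hR1 : 1 ≤ R := (le_max_right _ _).trans ((le_max_left _ _).trans hR)
  have hRc : (C / w + M) ≤ c / 2 * R := by
    have := (le_max_right _ _).trans hR
    rw [div_le_iff₀ hc] at this
    linarith
  have hR0 : 0 < R := by linarith
  have huc : ContinuousOn u (Set.Icc R (2 * R)) := fun r hr =>
    (hu r (hR0.trans_le hr.1)).continuousAt.continuousWithinAt
  have hvc : ContinuousOn v (Set.Icc R (2 * R)) := fun r hr =>
    (hv r (hR0.trans_le hr.1)).continuousAt.continuousWithinAt
  have hR2 : R ≤ 2 * R := by linarith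
  set B : Set ℝ := {r | r ∈ Set.Icc R (2 * R) ∧ η ≤ |u r|} with hB
  have hBm : MeasurableSet B := by
    have : IsClosed B := by
      have := huc.abs.preimage_isClosed_of_isClosed isClosed_Icc (isClosed_Ici (a := η))
      exact this
    exact this.measurableSet
  have hBsub : B ⊆ Set.Icc R (2 * R) := fun r hr => hr.1
  have hBfin : volume B ≠ ⊤ := ((measure_mono hBsub).trans_lt measure_Icc_lt_top).ne
  -- D = (uv)' and 2w²u² = (v² + w²u²) - D + (m/r²)u². The integral of D is a bounded boundary term,
  -- so the energy bound forces ∫u² over [R, 2R] to grow like R.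
  let D : ℝ → ℝ := fun r => v r * v r + u r * ((m / r ^ 2 - w ^ 2) * u r)
  have hDc : ContinuousOn D (Set.Icc R (2 * R)) := by
    refine (hvc.mul hvc).add (huc.mul (((continuousOn_const.div (continuousOn_id.pow 2) ?_).sub
      continuousOn_const).mul huc))
    intro r hr
    have : 0 < r := hR0.trans_le hr.1
    exact pow_ne_zero 2 this.ne'
  have hDi : ∫ r in R..(2 * R), D r = u (2 * R) * v (2 * R) - u R * v R := by
    refine intervalIntegral.integral_eq_sub_of_hasDerivAt (f := fun r => u r * v r) ?_ ?_
    · intro r hr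
      rw [Set.uIcc_of_le hR2] at hr
      have hr0 : 0 < r := hR0.trans_le hr.1
      exact (hu r hr0).mul (hv r hr0)
    · exact (hDc.mono (by rw [Set.uIcc_of_le hR2])).intervalIntegrable
  have hu2c : ContinuousOn (fun r => u r ^ 2) (Set.Icc R (2 * R)) := huc.pow 2
  have hlow : c / 2 * R ≤ 2 * w ^ 2 * ∫ r in R..(2 * R), u r ^ 2 := by
    have h1 : ∫ r in R..(2 * R), (c - M / R ^ 2 - D r) ≤ ∫ r in R..(2 * R), 2 * w ^ 2 * u r ^ 2 := by
      refine intervalIntegral.integral_mono_on hR2 ?_ ?_ ?_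
      · exact ((continuousOn_const.sub hDc).mono
          (by rw [Set.uIcc_of_le hR2])).intervalIntegrable
      · exact ((continuousOn_const.mul hu2c).mono
          (by rw [Set.uIcc_of_le hR2])).intervalIntegrable
      · intro r hr
        have hr0 : 0 < r := hR0.trans_le hr.1
        have e1 := (hE r (hRr.trans hr.1)).1
        have e2 : |m / r ^ 2 * u r ^ 2| ≤ M / R ^ 2 := by
          rw [abs_mul, abs_div, abs_of_nonneg (sq_nonneg (u r)), abs_of_pos (pow_pos hr0 2)]
          calc |m| / r ^ 2 * u r ^ 2 ≤ |m| / R ^ 2 * (C / w ^ 2) := by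
                gcongr
                · exact hr.1
                · exact hu2 r (hRr.trans hr.1)
            _ = M / R ^ 2 := by rw [hM]; ring
        have e3 := (abs_le.1 e2).1
        simp only [D]
        nlinarith
    rw [intervalIntegral.integral_const_mul] at h1
    refine le_trans ?_ h1
    rw [intervalIntegral.integral_sub intervalIntegrable_const ((hDc.mono
      (by rw [Set.uIcc_of_le hR2])).intervalIntegrable), hDi, intervalIntegral.integral_const,
      smul_eq_mul]
    have e1 := (abs_le.1 (huv (2 * R) (by linarith))).2
    have e2 := (abs_le.1 (huv R hRr)).1
    have e3 : C / (2 * w) + C / (2 * w) = C / w := by field_simp; norm_num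
    have e4 : (2 * R - R) * (c - M / R ^ 2) = c * R - M / R := by field_simp; ring
    have e5 : M / R ≤ M := div_le_self hM0 hR1
    rw [e4]
    linarith
  have hup : ∫ r in R..(2 * R), u r ^ 2 ≤ η ^ 2 * R + C / w ^ 2 * (volume B).toReal := by
    have h1 : ∫ r in R..(2 * R), u r ^ 2 ≤
        ∫ r in R..(2 * R), (η ^ 2 + B.indicator (fun _ => C / w ^ 2) r) := by
      refine intervalIntegral.integral_mono_on hR2 ?_ ?_ ?_
      · exact (hu2c.mono (by rw [Set.uIcc_of_le hR2])).intervalIntegrable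
      · refine intervalIntegrable_const.add (IntegrableOn.intervalIntegrable ?_)
        exact ((integrable_indicator_iff hBm).2 (integrableOn_const hBfin)).integrableOn
      · intro r hr
        by_cases hrB : r ∈ B
        · rw [Set.indicator_of_mem hrB]
          nlinarith [hu2 r (hRr.trans hr.1), sq_nonneg η]
        · rw [Set.indicator_of_notMem hrB, add_zero, ← sq_abs (u r)]
          have : |u r| < η := by
            by_contra h
            exact hrB ⟨hr, not_lt.1 h⟩
          gcongr
    refine h1.trans ?_
    rw [intervalIntegral.integral_add intervalIntegrable_const (IntegrableOn.intervalIntegrable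
      ((integrable_indicator_iff hBm).2 (integrableOn_const hBfin)).integrableOn),
      intervalIntegral.integral_const, intervalIntegral.integral_of_le hR2,
      integral_indicator hBm, setIntegral_const, smul_eq_mul, smul_eq_mul]
    have : (volume.restrict (Set.Ioc R (2 * R))).real B ≤ (volume B).toReal :=
      ENNReal.toReal_mono hBfin (Measure.restrict_apply_le _ _)
    have h5 : 0 ≤ C / w ^ 2 := by positivity
    nlinarith
  rw [ENNReal.ofReal_le_iff_le_toReal hBfin]
  have h2 : c / 2 * R ≤ 2 * w ^ 2 * (c / (8 * w ^ 2) * R + C / w ^ 2 * (volume B).toReal) := by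
    rw [← hη2]
    refine hlow.trans ?_
    gcongr
  have h3 : 2 * w ^ 2 * (c / (8 * w ^ 2) * R + C / w ^ 2 * (volume B).toReal) =
      c / 4 * R + 2 * C * (volume B).toReal := by
    field_simp; ring
  rw [h3] at h2
  have h4 : c / (8 * C) * R = (c / 4 * R) / (2 * C) := by field_simp; norm_num
  rw [h4, div_le_iff₀ (by positivity)]
  linarith

end Oscillation

/-! ### The radial profile of the Fourier transform and its ODE. -/

section RadialProfile

variable {d k : ℕ} {V : Submodule ℝ (EuclideanSpace ℝ (Fin d))}

theorem reflection_orthogonal_singleton_apply {E : Type*} [NormedAddCommGroup E]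
    [InnerProductSpace ℝ E] (v x : E) :
    (ℝ ∙ v)ᗮ.reflection x = x - (2 * (inner ℝ v x / ‖v‖ ^ 2)) • v := by
  rw [Submodule.reflection_orthogonal_apply, Submodule.reflection_singleton_apply]
  simp only [RCLike.ofReal_real_eq_id, id]
  rw [neg_sub, mul_smul, two_smul, two_smul]

theorem reflection_orthogonal_singleton_mem_iff {v : EuclideanSpace ℝ (Fin d)} (hv : v ∈ V)
    (x : EuclideanSpace ℝ (Fin d)) : (ℝ ∙ v)ᗮ.reflection x ∈ V ↔ x ∈ V := by
  rw [reflection_orthogonal_singleton_apply]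
  exact V.sub_mem_iff_left (V.smul_mem _ hv)

theorem integral_sphereMeasure_comp_reflection (k : ℕ) {v : EuclideanSpace ℝ (Fin d)} (hv : v ∈ V)
    (f : EuclideanSpace ℝ (Fin d) → ℝ) :
    ∫ x, f ((ℝ ∙ v)ᗮ.reflection x) ∂(sphereMeasure k V) = ∫ x, f x ∂(sphereMeasure k V) :=
  (measurePreserving_sphereMeasure k (ℝ ∙ v)ᗮ.reflection
    (reflection_orthogonal_singleton_mem_iff hv)).integral_comp
    (ℝ ∙ v)ᗮ.reflection.toHomeomorph.measurableEmbedding f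

/-- The invariance of integrals of `cos (r ⟪x, e⟫)` over the sphere in the unit vector `e`. -/
theorem integral_cos_inner_eq (k : ℕ) {e e' : EuclideanSpace ℝ (Fin d)} (he : e ∈ V) (he' : e' ∈ V)
    (h : ‖e‖ = ‖e'‖) (r : ℝ) :
    ∫ x, Real.cos (r * inner ℝ x e) ∂(sphereMeasure k V) =
      ∫ x, Real.cos (r * inner ℝ x e') ∂(sphereMeasure k V) := by
  rw [← integral_sphereMeasure_comp_reflection k (V.sub_mem he he')
    (fun x => Real.cos (r * inner ℝ x e'))]
  refine integral_congr_ae (Filter.Eventually.of_forall fun x => ?_)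
  simp only
  -- Reflection in the hyperplane orthogonal to e - e' carries e to e', as the norms agree.
  have h2 := (ℝ ∙ (e - e'))ᗮ.reflection.inner_map_map x e
  rw [Submodule.reflection_sub h] at h2
  rw [h2]

theorem abs_inner_le_one {x e : EuclideanSpace ℝ (Fin d)} (hx : ‖x‖ = 1) (he : ‖e‖ = 1) :
    |inner ℝ x e| ≤ 1 := by
  simpa [hx, he] using abs_real_inner_le_norm x e

theorem hasDerivAt_integral_sphereMeasure [IsFiniteMeasure (sphereMeasure k V)]
    {f f' : ℝ → EuclideanSpace ℝ (Fin d) → ℝ} {C r : ℝ}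
    (hf : ∀ s, Continuous (f s)) (hf' : Continuous (f' r)) (hfC : ∀ s x, ‖x‖ = 1 → |f s x| ≤ C)
    (hfC' : ∀ s x, |s - r| < 1 → ‖x‖ = 1 → |f' s x| ≤ C)
    (hd : ∀ s x, HasDerivAt (fun s => f s x) (f' s x) s) :
    HasDerivAt (fun s => ∫ x, f s x ∂(sphereMeasure k V)) (∫ x, f' r x ∂(sphereMeasure k V)) r := by
  refine (hasDerivAt_integral_of_dominated_loc_of_deriv_le (bound := fun _ => C)
    (Metric.ball_mem_nhds r one_pos) (Filter.Eventually.of_forall fun s =>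
      (hf s).aestronglyMeasurable) ?_ hf'.aestronglyMeasurable ?_ (integrable_const C)
    (Filter.Eventually.of_forall fun x s _ => hd s x)).2
  · refine Integrable.of_bound (hf r).aestronglyMeasurable C ?_
    filter_upwards [sphereMeasure_ae_mem k V] with x hx
    exact hfC r x hx.2
  · filter_upwards [sphereMeasure_ae_mem k V] with x hx s hs
    exact hfC' s x (by simpa [Real.dist_eq] using hs) hx.2

theorem integrable_sphereMeasure_of_bound [IsFiniteMeasure (sphereMeasure k V)]
    {f : EuclideanSpace ℝ (Fin d) → ℝ} {C : ℝ} (hf : Continuous f)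
    (hC : ∀ x, ‖x‖ = 1 → |f x| ≤ C) : Integrable f (sphereMeasure k V) := by
  refine Integrable.of_bound hf.aestronglyMeasurable C ?_
  filter_upwards [sphereMeasure_ae_mem k V] with x hx
  exact hC x hx.2

/-- The infinitesimal rotation invariance of the sphere measure in the plane of `e` and `f`,
applied to the function `⟪x, f⟫ sin (r ⟪x, e⟫)`. -/
theorem integral_rotation_identity [IsFiniteMeasure (sphereMeasure k V)]
    {e f : EuclideanSpace ℝ (Fin d)} (he : e ∈ V) (hf : f ∈ V) (he1 : ‖e‖ = 1) (hf1 : ‖f‖ = 1)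
    (hef : inner ℝ e f = 0) (r : ℝ) :
    ∫ x, (inner ℝ x e * Real.sin (r * inner ℝ x e) -
      r * inner ℝ x f ^ 2 * Real.cos (r * inner ℝ x e)) ∂(sphereMeasure k V) = 0 := by
  -- Reflect along v_θ = cos θ f + sin θ e. Then c is ⟨x, v_θ⟩, while p and q are the e and f
  -- coordinates of the reflected point; primes denote θ-derivatives. The integral of q sin(rp) is
  -- constant in θ, so its derivative at 0 vanishes.
  let c : ℝ → EuclideanSpace ℝ (Fin d) → ℝ := fun θ x =>
    Real.cos θ * inner ℝ x f + Real.sin θ * inner ℝ x e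
  let c' : ℝ → EuclideanSpace ℝ (Fin d) → ℝ := fun θ x =>
    -Real.sin θ * inner ℝ x f + Real.cos θ * inner ℝ x e
  let p : ℝ → EuclideanSpace ℝ (Fin d) → ℝ := fun θ x => inner ℝ x e - 2 * c θ x * Real.sin θ
  let q : ℝ → EuclideanSpace ℝ (Fin d) → ℝ := fun θ x => inner ℝ x f - 2 * c θ x * Real.cos θ
  let p' : ℝ → EuclideanSpace ℝ (Fin d) → ℝ := fun θ x =>
    -(2 * c' θ x * Real.sin θ + 2 * c θ x * Real.cos θ)
  let q' : ℝ → EuclideanSpace ℝ (Fin d) → ℝ := fun θ x =>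
    -(2 * c' θ x * Real.cos θ + 2 * c θ x * -Real.sin θ)
  have habs : ∀ a b a' b' : ℝ, |a| ≤ 1 → |b| ≤ 1 → |a'| ≤ 1 → |b'| ≤ 1 → |a * b + a' * b'| ≤ 2 := by
    intro a b a' b' h1 h2 h3 h4
    refine (abs_add_le _ _).trans ?_
    rw [abs_mul, abs_mul]
    nlinarith [abs_nonneg a, abs_nonneg b, abs_nonneg a', abs_nonneg b']
  have hc : ∀ θ x, ‖x‖ = 1 → |c θ x| ≤ 2 := fun θ x hx =>
    habs _ _ _ _ (Real.abs_cos_le_one θ) (abs_inner_le_one hx hf1) (Real.abs_sin_le_one θ)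
      (abs_inner_le_one hx he1)
  have hc' : ∀ θ x, ‖x‖ = 1 → |c' θ x| ≤ 2 := fun θ x hx =>
    habs _ _ _ _ (by rw [abs_neg]; exact Real.abs_sin_le_one θ) (abs_inner_le_one hx hf1)
      (Real.abs_cos_le_one θ) (abs_inner_le_one hx he1)
  have hcs : ∀ (a t : ℝ), |a| ≤ 2 → |t| ≤ 1 → |2 * a * t| ≤ 4 := by
    intro a t h1 h2
    rw [abs_mul, abs_mul, abs_two]
    nlinarith [abs_nonneg a, abs_nonneg t]
  have hq : ∀ θ x, ‖x‖ = 1 → |q θ x| ≤ 5 := fun θ x hx => by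
    refine (abs_sub _ _).trans ?_
    linarith [abs_inner_le_one hx hf1, hcs _ _ (hc θ x hx) (Real.abs_cos_le_one θ)]
  have hp' : ∀ θ x, ‖x‖ = 1 → |p' θ x| ≤ 8 := fun θ x hx => by
    simp only [p']
    rw [abs_neg]
    refine (abs_add_le _ _).trans ?_
    linarith [hcs _ _ (hc' θ x hx) (Real.abs_sin_le_one θ),
      hcs _ _ (hc θ x hx) (Real.abs_cos_le_one θ)]
  have hq' : ∀ θ x, ‖x‖ = 1 → |q' θ x| ≤ 8 := fun θ x hx => by
    simp only [q']
    rw [abs_neg]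
    refine (abs_add_le _ _).trans ?_
    linarith [hcs _ _ (hc' θ x hx) (Real.abs_cos_le_one θ),
      hcs _ (-Real.sin θ) (hc θ x hx) (by rw [abs_neg]; exact Real.abs_sin_le_one θ)]
  have hdc : ∀ θ x, HasDerivAt (fun θ => c θ x) (c' θ x) θ := fun θ x =>
    ((Real.hasDerivAt_cos θ).mul_const _).add ((Real.hasDerivAt_sin θ).mul_const _)
  have hdp : ∀ θ x, HasDerivAt (fun θ => p θ x) (p' θ x) θ := fun θ x => by
    have := (((hdc θ x).const_mul 2).mul (Real.hasDerivAt_sin θ)).const_sub (inner ℝ x e)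
    exact this
  have hdq : ∀ θ x, HasDerivAt (fun θ => q θ x) (q' θ x) θ := fun θ x => by
    have := (((hdc θ x).const_mul 2).mul (Real.hasDerivAt_cos θ)).const_sub (inner ℝ x f)
    exact this
  have hconst : ∀ θ, ∫ x, q θ x * Real.sin (r * p θ x) ∂(sphereMeasure k V) =
      ∫ x, inner ℝ x f * Real.sin (r * inner ℝ x e) ∂(sphereMeasure k V) := by
    intro θ
    set v := Real.cos θ • f + Real.sin θ • e with hv
    have hvV : v ∈ V := V.add_mem (V.smul_mem _ hf) (V.smul_mem _ he)
    have hfe : inner ℝ f e = 0 := by rw [real_inner_comm]; exact hef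
    have hee : inner ℝ e e = (1 : ℝ) := by rw [real_inner_self_eq_norm_sq, he1]; norm_num
    have hff : inner ℝ f f = (1 : ℝ) := by rw [real_inner_self_eq_norm_sq, hf1]; norm_num
    have hv1 : ‖v‖ ^ 2 = 1 := by
      rw [← real_inner_self_eq_norm_sq, hv]
      simp only [inner_add_left, inner_add_right, real_inner_smul_left, real_inner_smul_right,
        hef, hfe, hee, hff]
      linarith [Real.sin_sq_add_cos_sq θ]
    rw [← integral_sphereMeasure_comp_reflection k hvV
      (fun x => inner ℝ x f * Real.sin (r * inner ℝ x e))]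
    refine integral_congr_ae (Filter.Eventually.of_forall fun x => ?_)
    have hvx : inner ℝ v x = c θ x := by
      rw [real_inner_comm, hv]
      simp only [inner_add_right, real_inner_smul_right, c]
    have hve : inner ℝ v e = Real.sin θ := by
      rw [hv]; simp only [inner_add_left, real_inner_smul_left, hfe, hee]; ring
    have hvf : inner ℝ v f = Real.cos θ := by
      rw [hv]; simp only [inner_add_left, real_inner_smul_left, hef, hff]; ring
    simp only [reflection_orthogonal_singleton_apply, hv1, div_one, inner_sub_left,
      real_inner_smul_left, hvx, hve, hvf, p, q]
  have hder : HasDerivAt (fun θ => ∫ x, q θ x * Real.sin (r * p θ x) ∂(sphereMeasure k V))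
      (∫ x, (q' 0 x * Real.sin (r * p 0 x) + q 0 x * (Real.cos (r * p 0 x) * (r * p' 0 x)))
        ∂(sphereMeasure k V)) 0 := by
    have hb : ∀ θ x, ‖x‖ = 1 → |q θ x * Real.sin (r * p θ x)| ≤ 5 := fun θ x hx => by
      rw [abs_mul]
      nlinarith [hq θ x hx, Real.abs_sin_le_one (r * p θ x), abs_nonneg (q θ x),
        abs_nonneg (Real.sin (r * p θ x))]
    refine hasDerivAt_integral_sphereMeasure (C := 8 + 5 * (|r| * 8))
      (f' := fun θ x => q' θ x * Real.sin (r * p θ x) +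
        q θ x * (Real.cos (r * p θ x) * (r * p' θ x)))
      (fun θ => by fun_prop) (by fun_prop) (fun θ x hx => (hb θ x hx).trans ?_)
      (fun θ x _ hx => ?_) (fun θ x => ?_)
    · have := abs_nonneg r
      linarith
    · refine (abs_add_le _ _).trans (add_le_add ?_ ?_)
      · rw [abs_mul]
        nlinarith [hq' θ x hx, Real.abs_sin_le_one (r * p θ x), abs_nonneg (q' θ x),
          abs_nonneg (Real.sin (r * p θ x))]
      · rw [abs_mul, abs_mul, abs_mul]
        have h1 : |r| * |p' θ x| ≤ |r| * 8 := mul_le_mul_of_nonneg_left (hp' θ x hx) (abs_nonneg r)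
        have h2 : |Real.cos (r * p θ x)| * (|r| * |p' θ x|) ≤ 1 * (|r| * 8) :=
          mul_le_mul (Real.abs_cos_le_one _) h1 (by positivity) zero_le_one
        rw [one_mul] at h2
        exact mul_le_mul (hq θ x hx) h2 (by positivity) (by norm_num)
    · exact (hdq θ x).mul ((hdp θ x).const_mul r).sin
  simp only [hconst] at hder
  have h0 := hder.unique (hasDerivAt_const (0 : ℝ)
    (∫ x, inner ℝ x f * Real.sin (r * inner ℝ x e) ∂(sphereMeasure k V)))
  have h1 : ∫ x, (q' 0 x * Real.sin (r * p 0 x) + q 0 x * (Real.cos (r * p 0 x) * (r * p' 0 x)))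
        ∂(sphereMeasure k V) = -2 * ∫ x, (inner ℝ x e * Real.sin (r * inner ℝ x e) -
      r * inner ℝ x f ^ 2 * Real.cos (r * inner ℝ x e)) ∂(sphereMeasure k V) := by
    rw [← integral_const_mul]
    refine integral_congr_ae (Filter.Eventually.of_forall fun x => ?_)
    simp only [q', q, p, p', c, c', Real.sin_zero, Real.cos_zero]
    ring_nf
  rw [h1] at h0
  linarith

/-- The profile `r ↦ ∫ cos (r ⟪x, e⟫) dμ(x)` solves the radial Helmholtz equation. -/
theorem radial_helmholtz [IsFiniteMeasure (sphereMeasure k V)]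
    {e : EuclideanSpace ℝ (Fin d)} {f : Fin k → EuclideanSpace ℝ (Fin d)} (he : e ∈ V)
    (he1 : ‖e‖ = 1) (hf : ∀ i, f i ∈ V) (hf1 : ∀ i, ‖f i‖ = 1) (hef : ∀ i, inner ℝ e (f i) = 0)
    (hsum : ∀ x ∈ V, inner ℝ x e ^ 2 + ∑ i, inner ℝ x (f i) ^ 2 = ‖x‖ ^ 2) (r : ℝ) :
    (k : ℝ) * (∫ x, inner ℝ x e * Real.sin (r * inner ℝ x e) ∂(sphereMeasure k V)) -
      r * ((∫ x, Real.cos (r * inner ℝ x e) ∂(sphereMeasure k V)) -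
        ∫ x, inner ℝ x e ^ 2 * Real.cos (r * inner ℝ x e) ∂(sphereMeasure k V)) = 0 := by
  have hmul : ∀ a t : ℝ, |a| ≤ 1 → |t| ≤ 1 → |a * t| ≤ 1 := fun a t h1 h2 => by
    rw [abs_mul]; nlinarith [abs_nonneg a, abs_nonneg t]
  have hi1 : Integrable (fun x => inner ℝ x e * Real.sin (r * inner ℝ x e)) (sphereMeasure k V) :=
    integrable_sphereMeasure_of_bound (C := 1) (by fun_prop) fun x hx =>
      hmul _ _ (abs_inner_le_one hx he1) (Real.abs_sin_le_one _)
  have hi2 : ∀ f : EuclideanSpace ℝ (Fin d), ‖f‖ = 1 →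
      Integrable (fun x => inner ℝ x f ^ 2 * Real.cos (r * inner ℝ x e)) (sphereMeasure k V) :=
    fun f hf => integrable_sphereMeasure_of_bound (C := 1) (by fun_prop) fun x hx =>
      hmul _ _ (by rw [sq]; exact hmul _ _ (abs_inner_le_one hx hf) (abs_inner_le_one hx hf))
        (Real.abs_cos_le_one _)
  have hi3 : Integrable (fun x => Real.cos (r * inner ℝ x e)) (sphereMeasure k V) :=
    integrable_sphereMeasure_of_bound (C := 1) (by fun_prop) fun x _ => Real.abs_cos_le_one _
  have hterm : ∀ i : Fin k, (∫ x, inner ℝ x e * Real.sin (r * inner ℝ x e) ∂(sphereMeasure k V)) =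
      r * ∫ x, inner ℝ x (f i) ^ 2 * Real.cos (r * inner ℝ x e) ∂(sphereMeasure k V) := by
    intro i
    have h := integral_rotation_identity (k := k) he (hf i) he1 (hf1 i) (hef i) r
    simp only [mul_assoc] at h
    rw [integral_sub hi1 ((hi2 _ (hf1 i)).const_mul r), integral_const_mul] at h
    exact sub_eq_zero.1 h
  -- Adding the rotation identities over the k directions orthogonal to e; on the sphere Σ⟨x, f_i⟩²
  -- = 1 - ⟨x, e⟩².
  have hsumk : (k : ℝ) * (∫ x, inner ℝ x e * Real.sin (r * inner ℝ x e) ∂(sphereMeasure k V)) =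
      ∑ i : Fin k, r * ∫ x, inner ℝ x (f i) ^ 2 * Real.cos (r * inner ℝ x e)
        ∂(sphereMeasure k V) := by
    rw [← Finset.sum_congr rfl fun i _ => hterm i, Finset.sum_const, Finset.card_univ,
      Fintype.card_fin, nsmul_eq_mul]
  rw [hsumk, ← Finset.mul_sum, ← integral_finsetSum _ (fun i _ => hi2 _ (hf1 i)),
    ← integral_sub hi3 (hi2 e he1), sub_eq_zero]
  congr 1
  refine integral_congr_ae ?_
  filter_upwards [sphereMeasure_ae_mem k V] with x hx
  have := hsum x hx.1
  rw [hx.2] at this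
  rw [← Finset.sum_mul]
  linear_combination Real.cos (r * inner ℝ x e) * this

/-- The profile of the Fourier transform of the sphere measure is of size at least a multiple of
`r ^ (-k / 2)` on a positive proportion of each interval `[R, 2R]`. -/
theorem exists_profile_lower_bound (hV : Module.finrank ℝ V = k + 1)
    [IsFiniteMeasure (sphereMeasure k V)] {e : EuclideanSpace ℝ (Fin d)} (heV : e ∈ V)
    (he1 : ‖e‖ = 1) :
    ∃ η δ R₀ : ℝ, 0 < η ∧ 0 < δ ∧ 0 < R₀ ∧ ∀ R, R₀ ≤ R →
      ENNReal.ofReal (δ * R) ≤ volume {r | r ∈ Set.Icc R (2 * R) ∧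
        η ≤ |r ^ ((k : ℝ) / 2) * ∫ x, Real.cos (r * inner ℝ x e) ∂(sphereMeasure k V)|} := by
  obtain ⟨b⟩ := exists_orthonormalBasis_subspace hV
  have hb1 : ‖(b 0 : EuclideanSpace ℝ (Fin d))‖ = 1 := b.norm_eq_one 0
  simp_rw [integral_cos_inner_eq k heV (b 0).2 (he1.trans hb1.symm)]
  have hode := radial_helmholtz (k := k) (b 0).2 hb1 (f := fun i : Fin k => b i.succ)
    (fun i => (b i.succ).2) (fun i => b.norm_eq_one i.succ)
    (fun i => b.inner_eq_zero (Fin.succ_ne_zero i).symm) (fun x hx => by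
      rw [← sum_sq_inner_of_mem b hx, Fin.sum_univ_succ]
      simp_rw [real_inner_comm x])
  set μ := sphereMeasure k V with hμ
  set a : EuclideanSpace ℝ (Fin d) := (b 0 : EuclideanSpace ℝ (Fin d)) with ha
  have hmul : ∀ a t : ℝ, |a| ≤ 1 → |t| ≤ 1 → |a * t| ≤ 1 := fun a t h1 h2 => by
    rw [abs_mul]; nlinarith [abs_nonneg a, abs_nonneg t]
  let F : ℝ → ℝ := fun r => ∫ x, Real.cos (r * inner ℝ x a) ∂μ
  let F₁ : ℝ → ℝ := fun r => ∫ x, inner ℝ x a * Real.sin (r * inner ℝ x a) ∂μ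
  let F₂ : ℝ → ℝ := fun r => ∫ x, inner ℝ x a ^ 2 * Real.cos (r * inner ℝ x a) ∂μ
  have hF : ∀ r, HasDerivAt F (-F₁ r) r := by
    intro r
    have h : HasDerivAt F (∫ x, -Real.sin (r * inner ℝ x a) * inner ℝ x a ∂μ) r := by
      refine hasDerivAt_integral_sphereMeasure (C := 1)
        (f' := fun s x => -Real.sin (s * inner ℝ x a) * inner ℝ x a)
        (fun s => by fun_prop) (by fun_prop) (fun s x _ => Real.abs_cos_le_one _)
        (fun s x _ hx => hmul _ _ (by rw [abs_neg]; exact Real.abs_sin_le_one _)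
          (abs_inner_le_one hx hb1)) (fun s x => ?_)
      simpa using ((hasDerivAt_id s).mul_const (inner ℝ x a)).cos
    refine h.congr_deriv ?_
    rw [← integral_neg]
    refine integral_congr_ae (Filter.Eventually.of_forall fun x => ?_)
    simp only; ring
  have hF₁ : ∀ r, HasDerivAt F₁ (F₂ r) r := by
    intro r
    have h : HasDerivAt F₁ (∫ x, inner ℝ x a * (Real.cos (r * inner ℝ x a) * inner ℝ x a) ∂μ)
        r := by
      refine hasDerivAt_integral_sphereMeasure (C := 1)
        (f' := fun s x => inner ℝ x a * (Real.cos (s * inner ℝ x a) * inner ℝ x a))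
        (fun s => by fun_prop) (by fun_prop)
        (fun s x hx => hmul _ _ (abs_inner_le_one hx hb1) (Real.abs_sin_le_one _))
        (fun s x _ hx => hmul _ _ (abs_inner_le_one hx hb1) (hmul _ _ (Real.abs_cos_le_one _)
          (abs_inner_le_one hx hb1))) (fun s x => ?_)
      have := (((hasDerivAt_id s).mul_const (inner ℝ x a)).sin).const_mul (inner ℝ x a)
      simpa using this
    refine h.congr_deriv ?_
    refine integral_congr_ae (Filter.Eventually.of_forall fun x => ?_)
    simp only; ring
  have hode' : ∀ r, (k : ℝ) * F₁ r - r * (F r - F₂ r) = 0 := hode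
  set κ : ℝ := (k : ℝ) / 2 with hκ
  -- The factor r^{k/2} removes the first-order term of F'' + (k/r)F' + F = 0, leaving m = κ(κ-1)
  -- and w = 1.
  let u : ℝ → ℝ := fun r => r ^ κ * F r
  let v : ℝ → ℝ := fun r => κ * r ^ (κ - 1) * F r + r ^ κ * -F₁ r
  have hu : ∀ r, 0 < r → HasDerivAt u (v r) r := fun r hr =>
    (Real.hasDerivAt_rpow_const (Or.inl hr.ne')).mul (hF r)
  have hv : ∀ r, 0 < r → HasDerivAt v ((κ * (κ - 1) / r ^ 2 - 1 ^ 2) * u r) r := by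
    intro r hr
    have h1 := (((Real.hasDerivAt_rpow_const (x := r) (p := κ - 1) (Or.inl hr.ne')).const_mul
      κ).mul (hF r)).add ((Real.hasDerivAt_rpow_const (x := r) (p := κ) (Or.inl hr.ne')).mul
        (hF₁ r).neg)
    refine h1.congr_deriv ?_
    have e1 : r ^ κ = r * r ^ (κ - 1) := by
      rw [Real.rpow_sub_one hr.ne']; field_simp
    have e2 : r ^ (κ - 1) = r * r ^ (κ - 1 - 1) := by
      rw [Real.rpow_sub_one hr.ne' (κ - 1)]; field_simp
    have e3 : (k : ℝ) = 2 * κ := by rw [hκ]; ring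
    have e4 := hode' r
    rw [e3] at e4
    simp only [u, e1, e2, Pi.neg_apply]
    field_simp
    linear_combination (-r) * e4
  -- F(0) is the total mass, which is nonzero; by continuity F does not vanish just to the right of
  -- 0.
  obtain ⟨r₀, hr₀, h0⟩ : ∃ r₀, 0 < r₀ ∧ u r₀ ≠ 0 := by
    have hF0 : F 0 ≠ 0 := by
      have : F 0 = μ.real Set.univ := by simp [F]
      rw [this, Measure.real, ENNReal.toReal_ne_zero]
      exact ⟨by rw [Ne, Measure.measure_univ_eq_zero]; exact sphereMeasure_ne_zero hV,
        measure_ne_top _ _⟩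
    have h1 : ∀ᶠ r in nhdsWithin (0 : ℝ) (Set.Ioi 0), F r ≠ 0 :=
      ((hF 0).continuousAt.eventually_ne hF0).filter_mono nhdsWithin_le_nhds
    obtain ⟨r, hr, hr0⟩ := (h1.and self_mem_nhdsWithin).exists
    have hr0 : 0 < r := hr0
    exact ⟨r, hr0, mul_ne_zero (by positivity) hr⟩
  exact exists_volume_lower_bound one_pos hu hv hr₀ h0

end RadialProfile

/-! ### Divergence of the Lorentz quasi-norm. -/

section Lorentz

variable {d : ℕ}

theorem lorentzNorm_congr_ae (p q : ℝ) {g g' : EuclideanSpace ℝ (Fin d) → ℂ}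
    (h : g =ᵐ[volume] g') : lorentzNorm p q g = lorentzNorm p q g' := by
  unfold lorentzNorm
  have : ∀ t : ℝ, volume {ξ | t < ‖g ξ‖} = volume {ξ | t < ‖g' ξ‖} := by
    intro t
    refine measure_congr ?_
    filter_upwards [h] with ξ hξ
    apply propext
    change t < ‖g ξ‖ ↔ t < ‖g' ξ‖
    rw [hξ]
  simp_rw [this]

theorem lintegral_inv_Ioo_eq_top {t₀ : ℝ} (ht₀ : 0 < t₀) :
    ∫⁻ t in Set.Ioo 0 t₀, (ENNReal.ofReal t)⁻¹ = ⊤ := by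
  by_contra h
  have h1 : ¬ IntegrableOn (fun x : ℝ => x ^ (-1 : ℝ)) (Set.Ioo 0 t₀) volume := by
    rw [intervalIntegral.integrableOn_Ioo_rpow_iff ht₀]
    norm_num
  refine h1 ⟨Measurable.aestronglyMeasurable (by fun_prop), ?_⟩
  refine lt_of_eq_of_lt (setLIntegral_congr_fun measurableSet_Ioo fun t ht => ?_)
    (lt_top_iff_ne_top.2 h)
  have ht0 : 0 < t := ht.1
  simp only [Real.rpow_neg_one]
  rw [Real.enorm_of_nonneg (by positivity), ENNReal.ofReal_inv_of_pos ht0]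

/-- A function whose distribution function is at least `c t ^ (-p)` near `t = 0` is in no Lorentz
space `L^{p,q}` with `q < ∞`. -/
theorem lorentzNorm_eq_top {p q c t₀ : ℝ} (hp : 0 < p) (hq : 0 < q) (hc : 0 < c) (ht₀ : 0 < t₀)
    {g : EuclideanSpace ℝ (Fin d) → ℂ}
    (h : ∀ t, 0 < t → t < t₀ → ENNReal.ofReal (c * t ^ (-p)) ≤ volume {ξ | t < ‖g ξ‖}) :
    lorentzNorm p q g = ⊤ := by
  unfold lorentzNorm
  rw [ENNReal.rpow_eq_top_iff_of_pos (by positivity), ← top_le_iff]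
  -- Since t (c t^{-p})^{1/p} = c^{1/p}, the integrand is at least K/t on (0, t₀).
  set K : ℝ≥0∞ := (ENNReal.ofReal (c ^ (1 / p))) ^ q with hK
  have hK0 : K ≠ 0 := by
    have : 0 < ENNReal.ofReal (c ^ (1 / p)) := ENNReal.ofReal_pos.2 (by positivity)
    exact (ENNReal.rpow_pos this ENNReal.ofReal_ne_top).ne'
  calc (⊤ : ℝ≥0∞) = ∫⁻ t in Set.Ioo 0 t₀, K * (ENNReal.ofReal t)⁻¹ := by
        rw [lintegral_const_mul _ (by fun_prop), lintegral_inv_Ioo_eq_top ht₀,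
          ENNReal.mul_top hK0]
    _ ≤ ∫⁻ t in Set.Ioo 0 t₀,
        (ENNReal.ofReal t * volume {ξ | t < ‖g ξ‖} ^ (1 / p)) ^ q / ENNReal.ofReal t := by
        refine setLIntegral_mono' measurableSet_Ioo fun t ht => ?_
        have ht0 : 0 < t := ht.1
        rw [div_eq_mul_inv]
        refine mul_le_mul_left (ENNReal.rpow_le_rpow ?_ hq.le) _
        calc ENNReal.ofReal (c ^ (1 / p))
            = ENNReal.ofReal t * ENNReal.ofReal (c * t ^ (-p)) ^ (1 / p) := by
              rw [ENNReal.ofReal_rpow_of_pos (by positivity), ← ENNReal.ofReal_mul ht0.le,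
                Real.mul_rpow hc.le (by positivity), ← Real.rpow_mul ht0.le]
              have : -p * (1 / p) = -1 := by field_simp
              rw [this, Real.rpow_neg_one, mul_left_comm, mul_inv_cancel₀ ht0.ne', mul_one]
          _ ≤ _ := by
              gcongr
              exact h t ht0 ht.2
    _ ≤ _ := lintegral_mono_set Set.Ioo_subset_Ioi_self

end Lorentz

/-! ### Size of the level sets in frequency space. -/

section LevelSets

variable {d k : ℕ} {V : Submodule ℝ (EuclideanSpace ℝ (Fin d))}

/-- The profile at 2π|Pξ| is the real part of the transform at ξ: for y in `V`, ⟨y, ξ⟩ = ⟨y, Pξ⟩,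
and the cosine integral depends only on the norm of Pξ. -/
theorem abs_integral_cos_le_norm_measureFourier [IsFiniteMeasure (sphereMeasure k V)]
    {e : EuclideanSpace ℝ (Fin d)} (heV : e ∈ V) (he1 : ‖e‖ = 1) (ξ : EuclideanSpace ℝ (Fin d)) :
    |∫ x, Real.cos (2 * Real.pi * ‖V.starProjection ξ‖ * inner ℝ x e) ∂(sphereMeasure k V)| ≤
      ‖measureFourier (sphereMeasure k V) ξ‖ := by
  refine le_trans (le_of_eq ?_) (Complex.abs_re_le_norm _)
  congr 1
  have hi : Integrable (fun y => Complex.exp (((-2 * Real.pi * inner ℝ y ξ : ℝ) : ℂ) * Complex.I))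
      (sphereMeasure k V) :=
    Integrable.of_bound (Continuous.aestronglyMeasurable (by fun_prop)) 1
      (Filter.Eventually.of_forall fun y => (Complex.norm_exp_ofReal_mul_I _).le)
  have h1 : (measureFourier (sphereMeasure k V) ξ).re =
      ∫ y, Real.cos (1 * inner ℝ y ((2 * Real.pi) • V.starProjection ξ)) ∂(sphereMeasure k V) := by
    unfold measureFourier
    rw [← Complex.reCLM_apply, ← Complex.reCLM.integral_comp_comm hi]
    refine integral_congr_ae ?_
    filter_upwards [sphereMeasure_ae_mem k V] with y hy
    rw [Complex.reCLM_apply, Complex.exp_ofReal_mul_I_re, real_inner_smul_right,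
      ← Submodule.inner_starProjection_left_eq_right, Submodule.starProjection_eq_self_iff.2 hy.1,
      ← Real.cos_neg]
    congr 1; ring
  rw [h1, integral_cos_inner_eq k (e' := (2 * Real.pi * ‖V.starProjection ξ‖) • e)
    (V.smul_mem _ (V.starProjection_apply_mem ξ)) (V.smul_mem _ heV)]
  · simp_rw [real_inner_smul_right, one_mul]
  · rw [norm_smul, norm_smul, he1, mul_one, Real.norm_of_nonneg (by positivity),
      Real.norm_of_nonneg (by positivity)]

/-- If `A` fills a fixed proportion of `[R, 2R]` for all large `R` and `a` is homogeneous,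
then `{ξ | a ξ ∈ A}` fills a fixed proportion of balls of large radius. -/
theorem exists_volume_ball_lower_bound {a : EuclideanSpace ℝ (Fin d) → ℝ} (ha : Continuous a)
    (hhom : ∀ (l : ℝ) (ξ), 0 ≤ l → a (l • ξ) = l * a ξ) {ξ₀ : EuclideanSpace ℝ (Fin d)}
    (hξ₀ : ‖ξ₀‖ < 2) (haξ₀ : 1 < a ξ₀) {A : Set ℝ} (hA : MeasurableSet A) {δ R₀ : ℝ} (hδ : 0 < δ)
    (hR₀ : 0 < R₀)
    (h : ∀ R, R₀ ≤ R → ENNReal.ofReal (δ * R) ≤ volume {r | r ∈ Set.Icc R (2 * R) ∧ r ∈ A}) :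
    ∃ c : ℝ, 0 < c ∧ ∀ R, R₀ ≤ R →
      ENNReal.ofReal (c * R ^ d) ≤ volume {ξ | ‖ξ‖ ≤ 4 * R ∧ a ξ ∈ A} := by
  set Ω : Set (EuclideanSpace ℝ (Fin d)) := {ξ | ‖ξ‖ < 2 ∧ 1 < a ξ} with hΩ
  have hΩo : IsOpen Ω :=
    (isOpen_lt continuous_norm continuous_const).inter (isOpen_lt continuous_const ha)
  have hΩ0 : 0 < volume Ω := hΩo.measure_pos volume ⟨ξ₀, hξ₀, haξ₀⟩
  have hΩf : volume Ω < ⊤ := (measure_mono (fun ξ hξ => by simpa using hξ.1)).trans_lt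
    (measure_ball_lt_top (x := (0 : EuclideanSpace ℝ (Fin d))) (r := 2))
  refine ⟨δ * (volume Ω).toReal, mul_pos hδ (ENNReal.toReal_pos hΩ0.ne' hΩf.ne), fun R hR => ?_⟩
  have hR0 : 0 < R := hR₀.trans_le hR
  set S : Set (EuclideanSpace ℝ (Fin d)) := {ξ | ‖ξ‖ ≤ 4 * R ∧ a ξ ∈ A} with hS
  let T : Set (ℝ × EuclideanSpace ℝ (Fin d)) :=
    {p | p.1 ∈ Set.Icc R (2 * R) ∧ p.2 ∈ Ω ∧ p.1 * a p.2 ∈ A}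
  have hT : MeasurableSet T :=
    (measurable_fst measurableSet_Icc).inter ((measurable_snd hΩo.measurableSet).inter
      ((measurable_fst.mul (ha.measurable.comp measurable_snd)) hA))
  -- The measure of T is computed in two ways. With ξ fixed, the hypothesis is used at scale a(ξ)R,
  -- which is at least R₀ because a(ξ) > 1 on Ω.
  have hlow : ENNReal.ofReal (δ * R) * volume Ω ≤ (volume.prod volume) T := by
    rw [Measure.prod_apply_symm hT, ← setLIntegral_const, ← lintegral_indicator hΩo.measurableSet]
    refine lintegral_mono fun ξ => ?_
    by_cases hξ : ξ ∈ Ω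
    · rw [Set.indicator_of_mem hξ]
      have ha1 : 1 < a ξ := hξ.2
      have ha0 : 0 < a ξ := by linarith
      have e : (fun l => (l, ξ)) ⁻¹' T =
          (fun l => a ξ * l) ⁻¹' {r | r ∈ Set.Icc (a ξ * R) (2 * (a ξ * R)) ∧ r ∈ A} := by
        ext l
        simp only [T, Set.mem_preimage, Set.mem_ofPred_eq, Set.mem_Icc, hξ, true_and]
        rw [mul_comm l]
        refine and_congr_left fun _ => and_congr (mul_le_mul_iff_right₀ ha0).symm ?_
        rw [mul_left_comm 2, mul_le_mul_iff_right₀ ha0]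
      rw [e, Real.volume_preimage_mul_left ha0.ne', abs_of_pos (inv_pos.2 ha0)]
      calc ENNReal.ofReal (δ * R) = ENNReal.ofReal (a ξ)⁻¹ * ENNReal.ofReal (δ * (a ξ * R)) := by
            rw [← ENNReal.ofReal_mul (by positivity)]
            congr 1
            field_simp
        _ ≤ _ := mul_le_mul_right (h _ (hR.trans (le_mul_of_one_le_left hR0.le ha1.le))) _
    · rw [Set.indicator_of_notMem hξ]
      exact bot_le
  -- With l in [R, 2R] fixed, the slice of T lies in the dilate of S by 1/l, of measure at most
  -- R^{-d}|S|.
  have hup : (volume.prod volume) T ≤ ENNReal.ofReal R * (ENNReal.ofReal (R ^ d)⁻¹ * volume S) := by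
    rw [Measure.prod_apply hT]
    have e : ENNReal.ofReal R = volume (Set.Icc R (2 * R)) := by
      rw [Real.volume_Icc]; congr 1; ring
    rw [e, mul_comm, ← setLIntegral_const, ← lintegral_indicator measurableSet_Icc]
    refine lintegral_mono fun l => ?_
    by_cases hl : l ∈ Set.Icc R (2 * R)
    · rw [Set.indicator_of_mem hl]
      have hl0 : 0 < l := hR0.trans_le hl.1
      have hsub : Prod.mk l ⁻¹' T ⊆ (fun ξ => l • ξ) ⁻¹' S := by
        rintro ξ ⟨-, hξ, hξA⟩
        refine ⟨?_, ?_⟩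
        · rw [norm_smul, Real.norm_of_nonneg hl0.le]
          have := hξ.1
          nlinarith [hl.2, norm_nonneg ξ]
        · rw [hhom _ _ hl0.le]; exact hξA
      refine (measure_mono hsub).trans ?_
      rw [Measure.addHaar_preimage_smul _ hl0.ne', finrank_euclideanSpace_fin,
        abs_of_pos (by positivity)]
      gcongr
      exact hl.1
    · rw [Set.indicator_of_notMem hl]
      have : Prod.mk l ⁻¹' T = ∅ := by
        ext ξ
        simp only [T, Set.mem_preimage, Set.mem_ofPred_eq, Set.mem_empty_iff_false, iff_false]
        exact fun h => hl h.1
      rw [this, measure_empty]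
  have hfin := hlow.trans hup
  have hSf : volume S ≠ ⊤ := ((measure_mono (fun ξ hξ => by simpa using hξ.1)).trans_lt
    (measure_closedBall_lt_top (x := (0 : EuclideanSpace ℝ (Fin d))) (r := 4 * R))).ne
  rw [← ENNReal.ofReal_toReal hΩf.ne, ← ENNReal.ofReal_toReal hSf,
    ← ENNReal.ofReal_mul (by positivity), ← ENNReal.ofReal_mul (by positivity),
    ← ENNReal.ofReal_mul hR0.le, ENNReal.ofReal_le_ofReal_iff (by positivity)] at hfin
  rw [← ENNReal.ofReal_toReal hSf]
  refine ENNReal.ofReal_le_ofReal ?_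
  have h2 : δ * (volume Ω).toReal * R ≤ (R ^ d)⁻¹ * (volume S).toReal * R := by linarith
  have h3 := le_of_mul_le_mul_right h2 hR0
  rwa [inv_mul_eq_div, le_div_iff₀ (by positivity)] at h3

/-- The level sets of the Fourier transform of the Riesz potential of the sphere measure. -/
theorem exists_levelSet_lower_bound (hk : 1 ≤ k) (hV : Module.finrank ℝ V = k + 1)
    [IsFiniteMeasure (sphereMeasure k V)] {α : ℝ} (hα : 0 < α) :
    ∃ c t₀ : ℝ, 0 < c ∧ 0 < t₀ ∧ ∀ t, 0 < t → t < t₀ →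
      ENNReal.ofReal (c * t ^ (-(2 * (d : ℝ) / (2 * α + k)))) ≤
        volume {ξ | t < ‖rieszFourier α (sphereMeasure k V) ξ‖} := by
  obtain ⟨b⟩ := exists_orthonormalBasis_subspace hV
  obtain ⟨e, heV, he1⟩ : ∃ e ∈ V, ‖e‖ = 1 := ⟨b 0, (b 0).2, b.norm_eq_one 0⟩
  have hpi := Real.pi_pos
  set κ : ℝ := (k : ℝ) / 2 with hκ
  have hk1 : (1 : ℝ) ≤ k := by exact_mod_cast hk
  have hκ0 : 0 < κ := by positivity
  obtain ⟨η, δ, R₀, hη, hδ, hR₀, hprof⟩ := exists_profile_lower_bound hV heV he1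
  set F : ℝ → ℝ := fun r => ∫ x, Real.cos (r * inner ℝ x e) ∂(sphereMeasure k V) with hF
  have hFc : Continuous F := by
    refine continuous_of_dominated (bound := fun _ => 1)
      (fun r => Continuous.aestronglyMeasurable (by fun_prop))
      (fun r => Filter.Eventually.of_forall fun x => Real.abs_cos_le_one _) (integrable_const 1)
      (Filter.Eventually.of_forall fun x => by fun_prop)
  let a : EuclideanSpace ℝ (Fin d) → ℝ := fun ξ => 2 * Real.pi * ‖V.starProjection ξ‖
  have hA : MeasurableSet {r : ℝ | η ≤ |r ^ κ * F r|} :=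
    (isClosed_le continuous_const
      (((Real.continuous_rpow_const hκ0.le).mul hFc).abs)).measurableSet
  obtain ⟨c, hc, hvol⟩ := exists_volume_ball_lower_bound (a := a) (by fun_prop)
    (fun l ξ hl => by
      simp only [a, map_smul, norm_smul, Real.norm_of_nonneg hl]; ring) (ξ₀ := e)
    (by rw [he1]; norm_num)
    (by
      simp only [a, Submodule.starProjection_eq_self_iff.2 heV, he1]
      linarith [Real.pi_gt_three]) hA hδ hR₀ hprof
  have hs0 : 0 < α + κ := by positivity
  have hlevel : ∀ R, R₀ ≤ R → ∀ ξ, ‖ξ‖ ≤ 4 * R ∧ a ξ ∈ {r : ℝ | η ≤ |r ^ κ * F r|} →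
      η * (8 * Real.pi * R) ^ (-(α + κ)) ≤ ‖rieszFourier α (sphereMeasure k V) ξ‖ := by
    rintro R hR ξ ⟨hξR, hξA⟩
    have hR0 : 0 < R := hR₀.trans_le hR
    have hξA : η ≤ |a ξ ^ κ * F (a ξ)| := hξA
    have ha0 : 0 ≤ a ξ := by positivity
    -- At ξ = 0 the factor r^κ vanishes because κ > 0, contradicting the lower bound η.
    have hane : ξ ≠ 0 := by
      rintro rfl
      simp only [a, map_zero, norm_zero, mul_zero, Real.zero_rpow hκ0.ne', zero_mul, abs_zero] at hξA
      linarith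
    have hξ0 : 0 < ‖ξ‖ := norm_pos_iff.2 hane
    have h1 : 2 * Real.pi * ‖ξ‖ ≤ 8 * Real.pi * R := by nlinarith
    have h2 : a ξ ≤ 8 * Real.pi * R := by
      refine le_trans ?_ h1
      simp only [a]
      gcongr
      exact V.norm_starProjection_apply_le ξ
    have h3 : |F (a ξ)| ≤ ‖measureFourier (sphereMeasure k V) ξ‖ :=
      abs_integral_cos_le_norm_measureFourier heV he1 ξ
    have h4 : η * (8 * Real.pi * R) ^ (-κ) ≤ |F (a ξ)| := by
      rw [Real.rpow_neg (by positivity), ← div_eq_mul_inv, div_le_iff₀ (by positivity)]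
      refine hξA.trans ?_
      rw [abs_mul, abs_of_nonneg (by positivity), mul_comm]
      gcongr
    rw [rieszFourier, norm_mul, Complex.norm_real, Real.norm_of_nonneg (by positivity), neg_add,
      Real.rpow_add (by positivity)]
    have h5 : (8 * Real.pi * R) ^ (-α) ≤ (2 * Real.pi * ‖ξ‖) ^ (-α) :=
      Real.rpow_le_rpow_of_nonpos (by positivity) h1 (by linarith)
    calc η * ((8 * Real.pi * R) ^ (-α) * (8 * Real.pi * R) ^ (-κ))
        = (8 * Real.pi * R) ^ (-α) * (η * (8 * Real.pi * R) ^ (-κ)) := by ring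
      _ ≤ _ := mul_le_mul h5 (h4.trans h3) (by positivity) (by positivity)
  refine ⟨c * ((8 * Real.pi) ^ d)⁻¹ * (2 / η) ^ (-(2 * (d : ℝ) / (2 * α + k))),
    η / 2 * (8 * Real.pi * R₀) ^ (-(α + κ)), by positivity, by positivity, fun t ht htt => ?_⟩
  -- R solves η(8πR)^{-(α+κ)} = 2t; the factor 2 yields the strict inequality defining the level
  -- set, and t < t₀ ensures R ≥ R₀.
  set R : ℝ := (2 / η * t) ^ (-(1 / (α + κ))) / (8 * Real.pi) with hRdef
  have hx : 8 * Real.pi * R = (2 / η * t) ^ (-(1 / (α + κ))) := by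
    rw [hRdef]; field_simp
  have hpow : (8 * Real.pi * R) ^ (-(α + κ)) = 2 / η * t := by
    rw [hx, ← Real.rpow_mul (by positivity)]
    have : -(1 / (α + κ)) * -(α + κ) = 1 := by field_simp
    rw [this, Real.rpow_one]
  have hRpos : 0 < R := by positivity
  have hRR : R₀ ≤ R := by
    by_contra hlt
    rw [not_le] at hlt
    have h1 : (8 * Real.pi * R₀) ^ (-(α + κ)) ≤ (8 * Real.pi * R) ^ (-(α + κ)) :=
      Real.rpow_le_rpow_of_nonpos (by positivity) (by gcongr) (by linarith)
    rw [hpow] at h1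
    have h2 : η / 2 * (8 * Real.pi * R₀) ^ (-(α + κ)) ≤ η / 2 * (2 / η * t) := by gcongr
    have h3 : η / 2 * (2 / η * t) = t := by field_simp
    linarith
  refine le_trans (le_trans (le_of_eq ?_) (hvol R hRR)) (measure_mono fun ξ hξ => ?_)
  · congr 1
    have h1 : R ^ d = ((8 * Real.pi) ^ d)⁻¹ * (8 * Real.pi * R) ^ d := by
      rw [mul_pow (8 * Real.pi)]; field_simp
    have h2 : (8 * Real.pi * R) ^ d = (2 / η * t) ^ (-(2 * (d : ℝ) / (2 * α + k))) := by
      rw [hx, ← Real.rpow_natCast, ← Real.rpow_mul (by positivity)]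
      congr 1
      have : 2 * α + k = 2 * (α + κ) := by rw [hκ]; ring
      rw [this]
      field_simp
    rw [h1, h2, Real.mul_rpow (by positivity) ht.le]
    ring
  · have h1 := hlevel R hRR ξ hξ
    rw [hpow] at h1
    have h2 : η * (2 / η * t) = 2 * t := by field_simp
    rw [h2] at h1
    change t < _
    linarith

end LevelSets

/-! ### Assembly of the main theorem. -/

theorem theorem1p6 (d k : ℕ) (hk : 1 ≤ k) (hkd : k + 1 ≤ d)
    (V : Submodule ℝ (EuclideanSpace ℝ (Fin d))) (hV : Module.finrank ℝ V = k + 1)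
    (α : ℝ) (hα₁ : ((d : ℝ) - k) / 2 < α) (hα₂ : α < (d : ℝ) - (k : ℝ) / 2) :
    (IsFiniteMeasure (sphereMeasure k V) ∧ (sphereMeasure k V).Regular) ∧
    besovNorm (k : ℝ) (sphereMeasure k V) < ⊤ ∧
    (∀ᵐ x, rieszPotential α (sphereMeasure k V) x < ⊤) ∧
    (∃ g : EuclideanSpace ℝ (Fin d) → ℂ, HasDistribFourierTransform
      (fun x => ((rieszPotential α (sphereMeasure k V) x).toReal : ℂ)) g) ∧
    ∀ g : EuclideanSpace ℝ (Fin d) → ℂ, HasDistribFourierTransform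
      (fun x => ((rieszPotential α (sphereMeasure k V) x).toReal : ℂ)) g →
      ∀ q : ℝ, 0 < q → lorentzNorm (2 * (d : ℝ) / (2 * α + k)) q g = ⊤ := by
  have hfin := isFiniteMeasure_sphereMeasure hV
  have hkd' : (k : ℝ) + 1 ≤ d := by exact_mod_cast hkd
  have hk' : (1 : ℝ) ≤ k := by exact_mod_cast hk
  have hα : 0 < α := by linarith
  have hαd : α < d := by linarith
  obtain ⟨C, hC, hball⟩ := exists_sphereMeasure_closedBall_le hV
  have hdist := hasDistribFourierTransform_rieszPotential (μ := sphereMeasure k V) hα hαd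
  refine ⟨⟨hfin, inferInstance⟩, besovNorm_lt_top hC hball, ae_rieszPotential_lt_top hα hαd,
    ⟨_, hdist⟩, fun g hg q hq => ?_⟩
  obtain ⟨c, t₀, hc, ht₀, h⟩ := exists_levelSet_lower_bound hk hV hα
  -- An arbitrary representative `g` may be replaced by the explicit (2π|ξ|)^{-α} μ̂(ξ).
  rw [lorentzNorm_congr_ae _ _ (hg.ae_eq hdist)]
  exact lorentzNorm_eq_top (div_pos (by linarith) (by linarith)) hq hc ht₀ h
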